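/- Let $(\Omega,\mathcal F)$ be a measurable space and let $\mathfrak P$ be a nonempty set of probability measures on it. Put $\mathbf c(A)=\sup_{\mathbb P\in\mathfrak P}\mathbb P(A)$ for $A\in\mathcal F$; an event $A$ is *polar* if $\mathbf c(A)=0$, and a property holds *quasi surely* (q.s.) if it holds outside a polar event. Let $L^0_{\mathbf c}$ be the vector lattice of real random variables modulo q.s. equality with the q.s. order $\preceq$, and let $L^\infty_{\mathbf c}=\{X\in L^0_{\mathbf c}\mid \exists\, m>0:\ |X|\preceq m\mathbf 1_\Omega\}$. Let $ca_{\mathbf c}$ be the space of finite countably additive signed measures $\mu$ on $\mathcal F$ such that $|\mu|(N)=0$ for every polar event $N$. A measure $\mu$ is *supported* if there is $S\in\mathcal F$ with $\mu(S^c)=0$ such that $N\cap S$ is polar whenever $N\in\mathcal F$ and $\mu(N\cap S)=0$; let $sca_{\mathbf c}$ be the set of $\mu\in ca_{\mathbf c}$ for which $|\mu|$ is supported. $\mathfrak P$ is *of class (S)* if there is a nonempty set $\mathfrak Q$ of supported probability measures that is equivalent to $\mathfrak P$, i.e. for every event $N$ one has $\sup_{\mathbb Q\in\mathfrak Q}\mathbb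 Q(N)=0$ if and only if $\mathbf c(N)=0$. A set $\mathcal C\subset L^\infty_{\mathbf c}$ is *solid* if $Y\in\mathcal C$, $X\in L^\infty_{\mathbf c}$ and $|X|\preceq|Y|$ imply $X\in\mathcal C$. It is *order closed* if $X\in\mathcal C$ whenever $(X_\alpha)_{\alpha\in I}$ is a net in $\mathcal C$, $X\in L^\infty_{\mathbf c}$, and there is a decreasing net $(Y_\alpha)_{\alpha\in I}$ in $L^\infty_{\mathbf c}$ with $\inf_{\alpha} Y_\alpha=0$ and $|X_\alpha-X|\preceq Y_\alpha$ for all $\alpha\in I$. For $M\subset ca_{\mathbf c}$, $\sigma(L^\infty_{\mathbf c},M)$ is the coarsest topology on $L^\infty_{\mathbf c}$ for which $X\mapsto\int X\,d\mu$ is continuous for every $\mu\in M$. Then: (1) $\mathfrak P$ is of class (S) if and only if every nonempty convex solid set $\mathcal C\subset L^\infty_{\mathbf c}$ satisfies: $\mathcal C$ is order closed if and only if $\mathcal C$ is $\sigma(L^\infty_{\mathbf c},sca_{\mathbf c})$-closed. (2) $sca_{\mathbf c}=ca_{\mathbf c}$ if and only if every nonempty convex solid set $\mathcal C\subset L^\infty_{\mathbf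 c}$ satisfies: $\mathcal C$ is order closed if and only if $\mathcal C$ is $\sigma(L^\infty_{\mathbf c},ca_{\mathbf c})$-closed. -/

import Mathlib

open MeasureTheory Set Filter
open scoped ENNReal Topology

universe u

namespace QuasiSure

section SetFunctions

variable {Ω : Type u} [MeasurableSpace Ω]

/-- The upper probability `c(A) = sup_{ℙ ∈ 𝔓} ℙ(A)`. -/
noncomputable def upperProb (𝔓 : Set (ProbabilityMeasure Ω)) (A : Set Ω) : ℝ≥0∞ :=
  ⨆ P ∈ 𝔓, (P : Measure Ω) A

/-- An event `A` is `𝔓`-polar if `c(A) = 0`. -/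
def IsPolar (𝔓 : Set (ProbabilityMeasure Ω)) (A : Set Ω) : Prop :=
  MeasurableSet A ∧ upperProb 𝔓 A = 0

/-- `𝔖 ≪ 𝔗` for sets of finite signed measures: every event which is null for (the modulus of)
all members of `𝔗` is null for all members of `𝔖`. -/
def Dominated (𝔖 𝔗 : Set (SignedMeasure Ω)) : Prop :=
  ∀ N : Set Ω, MeasurableSet N →
    (⨆ ν ∈ 𝔗, ν.totalVariation N) = 0 → (⨆ μ ∈ 𝔖, μ.totalVariation N) = 0

/-- A set of probability measures, seen as a set of finite signed measures. -/
noncomputable def asSigned (𝔓 : Set (ProbabilityMeasure Ω)) : Set (SignedMeasure Ω) :=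
  (fun P : ProbabilityMeasure Ω => (P : Measure Ω).toSignedMeasure) '' 𝔓

/-- `𝔓 ≈ 𝔔`: mutual domination. -/
def Equivalent (𝔓 𝔔 : Set (ProbabilityMeasure Ω)) : Prop :=
  Dominated (asSigned 𝔓) (asSigned 𝔔) ∧ Dominated (asSigned 𝔔) (asSigned 𝔓)

/-- The space `ca_c` of finite signed measures dominated by `𝔓`. -/
def ca (𝔓 : Set (ProbabilityMeasure Ω)) : Set (SignedMeasure Ω) :=
  {μ | Dominated {μ} (asSigned 𝔓)}

/-- A measure `μ` is supported if there is an event `S` carrying `μ` all of whose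
`μ`-null sub-events are `𝔓`-polar. -/
def Supported (𝔓 : Set (ProbabilityMeasure Ω)) (μ : Measure Ω) : Prop :=
  ∃ S : Set Ω, MeasurableSet S ∧ μ Sᶜ = 0 ∧
    ∀ N : Set Ω, MeasurableSet N → μ (N ∩ S) = 0 → IsPolar 𝔓 (N ∩ S)

/-- The space `sca_c` of supported signed measures in `ca_c`. -/
def sca (𝔓 : Set (ProbabilityMeasure Ω)) : Set (SignedMeasure Ω) :=
  {μ | μ ∈ ca 𝔓 ∧ Supported 𝔓 μ.totalVariation}

/-- `𝔓` is of class (S): there is an equivalent nonempty set of supported probability measures. -/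
def ClassS (𝔓 : Set (ProbabilityMeasure Ω)) : Prop :=
  ∃ 𝔔 : Set (ProbabilityMeasure Ω), 𝔔.Nonempty ∧ Equivalent 𝔔 𝔓 ∧
    ∀ Q ∈ 𝔔, Supported 𝔓 (Q : Measure Ω)

/-- The filter of events (and their supersets) with polar complement: `∀ᶠ ω in qs 𝔓, p ω` says
that `p` holds outside a `𝔓`-polar event. -/
def qs (𝔓 : Set (ProbabilityMeasure Ω)) : Filter Ω where
  sets := {s | ∃ N, IsPolar 𝔓 N ∧ Nᶜ ⊆ s}
  univ_sets := ⟨∅, ⟨MeasurableSet.empty, by simp [upperProb]⟩, by simp⟩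
  sets_of_superset := fun ⟨N, hN, h⟩ hst => ⟨N, hN, h.trans hst⟩
  inter_sets := by
    rintro s t ⟨N, ⟨hN, hN0⟩, hs⟩ ⟨M, ⟨hM, hM0⟩, ht⟩
    refine ⟨N ∪ M, ⟨hN.union hM, ?_⟩, ?_⟩
    · simp only [upperProb, ENNReal.iSup_eq_zero] at *
      intro P hP
      exact measure_union_null (hN0 P hP) (hM0 P hP)
    · rw [compl_union]
      exact inter_subset_inter hs ht

/-- For events, "outside a polar event" means that the complement is polar. -/
theorem isPolar_compl_iff {𝔓 : Set (ProbabilityMeasure Ω)} {s : Set Ω} (hs : MeasurableSet s) :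
    IsPolar 𝔓 sᶜ ↔ s ∈ qs 𝔓 := by
  constructor
  · intro h
    exact ⟨sᶜ, h, by simp⟩
  · rintro ⟨N, ⟨_, hN0⟩, h⟩
    refine ⟨hs.compl, ?_⟩
    simp only [upperProb, ENNReal.iSup_eq_zero] at *
    intro P hP
    exact measure_mono_null (compl_subset_comm.mp h) (hN0 P hP)

end SetFunctions

section FunctionSpaces

/-- The space of real-valued random variables. -/
def measurableFun (Ω : Type u) [MeasurableSpace Ω] : Submodule ℝ (Ω → ℝ) where
  carrier := {f | Measurable f}
  add_mem' := fun hf hg => Measurable.add hf hg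
  zero_mem' := measurable_const
  smul_mem' := fun c _ hf => Measurable.const_smul hf c

variable {Ω : Type u} [MeasurableSpace Ω]

theorem isPolar_pos_iff {𝔓 : Set (ProbabilityMeasure Ω)} (f : measurableFun Ω) :
    upperProb 𝔓 {ω | 0 < |f.1 ω|} = 0 ↔ ∀ᶠ ω in qs 𝔓, f.1 ω = 0 := by
  have hf : Measurable f.1 := f.2
  have hm : MeasurableSet {ω | f.1 ω = 0} := measurableSet_eq_fun hf measurable_const
  have e : {ω | 0 < |f.1 ω|} = {ω | f.1 ω = 0}ᶜ := by ext ω; simp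
  rw [e]
  exact ⟨fun h => (isPolar_compl_iff hm).1 ⟨hm.compl, h⟩, fun h => ((isPolar_compl_iff hm).2 h).2⟩

/-- The random variables `f` with `c(|f| > 0) = 0`. -/
def nullFun (𝔓 : Set (ProbabilityMeasure Ω)) : Submodule ℝ (measurableFun Ω) where
  carrier := {f | upperProb 𝔓 {ω | 0 < |f.1 ω|} = 0}
  add_mem' := by
    intro f g hf hg
    simp only [mem_ofPred_eq, isPolar_pos_iff] at *
    filter_upwards [hf, hg] with ω h1 h2
    simp [h1, h2]
  zero_mem' := by simp [upperProb]
  smul_mem' := by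
    intro c f hf
    simp only [mem_ofPred_eq, isPolar_pos_iff] at *
    filter_upwards [hf] with ω h1
    simp [h1]

/-- The space `L⁰_c` of random variables up to `𝔓`-quasi-sure equality. -/
def L0 (𝔓 : Set (ProbabilityMeasure Ω)) : Type u := measurableFun Ω ⧸ nullFun 𝔓

variable (𝔓 : Set (ProbabilityMeasure Ω))

instance : AddCommGroup (L0 𝔓) := inferInstanceAs (AddCommGroup (measurableFun Ω ⧸ nullFun 𝔓))

instance : Module ℝ (L0 𝔓) := inferInstanceAs (Module ℝ (measurableFun Ω ⧸ nullFun 𝔓))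

/-- The equivalence class generated by a random variable. -/
def L0.mk : measurableFun Ω →ₗ[ℝ] L0 𝔓 := (nullFun 𝔓).mkQ

theorem L0.mk_surjective : Function.Surjective (L0.mk 𝔓) := (nullFun 𝔓).mkQ_surjective

variable {𝔓}

theorem L0.mk_eq_mk {f g : measurableFun Ω} :
    L0.mk 𝔓 f = L0.mk 𝔓 g ↔ ∀ᶠ ω in qs 𝔓, f.1 ω = g.1 ω := by
  have h : L0.mk 𝔓 f = L0.mk 𝔓 g ↔ f - g ∈ nullFun 𝔓 := Submodule.Quotient.eq _
  rw [h]
  change upperProb 𝔓 {ω | 0 < |(f - g).1 ω|} = 0 ↔ _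
  rw [isPolar_pos_iff]
  simp [sub_eq_zero]

/-- The quasi-sure order: `X ≤ Y` if `f ≤ g` quasi surely for all representatives. -/
instance : LE (L0 𝔓) where
  le X Y := ∀ f g : measurableFun Ω, L0.mk 𝔓 f = X → L0.mk 𝔓 g = Y → ∀ᶠ ω in qs 𝔓, f.1 ω ≤ g.1 ω

theorem L0.mk_le_mk {f g : measurableFun Ω} :
    L0.mk 𝔓 f ≤ L0.mk 𝔓 g ↔ ∀ᶠ ω in qs 𝔓, f.1 ω ≤ g.1 ω := by
  constructor
  · intro h
    exact h f g rfl rfl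
  · intro h f' g' hf hg
    filter_upwards [h, L0.mk_eq_mk.1 hf, L0.mk_eq_mk.1 hg] with ω h0 h1 h2
    rwa [h1, h2]

instance : PartialOrder (L0 𝔓) where
  le_refl X := by
    obtain ⟨f, rfl⟩ := L0.mk_surjective 𝔓 X
    exact L0.mk_le_mk.2 (Eventually.of_forall fun ω => le_rfl)
  le_trans X Y Z := by
    obtain ⟨f, rfl⟩ := L0.mk_surjective 𝔓 X
    obtain ⟨g, rfl⟩ := L0.mk_surjective 𝔓 Y
    obtain ⟨h, rfl⟩ := L0.mk_surjective 𝔓 Z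
    simp only [L0.mk_le_mk]
    intro h1 h2
    filter_upwards [h1, h2] with ω a b using a.trans b
  le_antisymm X Y := by
    obtain ⟨f, rfl⟩ := L0.mk_surjective 𝔓 X
    obtain ⟨g, rfl⟩ := L0.mk_surjective 𝔓 Y
    simp only [L0.mk_le_mk, L0.mk_eq_mk]
    intro h1 h2
    filter_upwards [h1, h2] with ω a b using le_antisymm a b

/-- Pointwise maximum of random variables. -/
def maxFun (f g : measurableFun Ω) : measurableFun Ω :=
  ⟨fun ω => max (f.1 ω) (g.1 ω), Measurable.max (f := f.1) (g := g.1) f.2 g.2⟩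

/-- Pointwise minimum of random variables. -/
def minFun (f g : measurableFun Ω) : measurableFun Ω :=
  ⟨fun ω => min (f.1 ω) (g.1 ω), Measurable.min (f := f.1) (g := g.1) f.2 g.2⟩

theorem isLUB_maxFun (f g : measurableFun Ω) :
    IsLUB {L0.mk 𝔓 f, L0.mk 𝔓 g} (L0.mk 𝔓 (maxFun f g)) := by
  constructor
  · rintro X (rfl | rfl)
    · exact L0.mk_le_mk.2 (Eventually.of_forall fun ω => le_max_left _ _)
    · exact L0.mk_le_mk.2 (Eventually.of_forall fun ω => le_max_right _ _)
  · intro X hX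
    obtain ⟨h, rfl⟩ := L0.mk_surjective 𝔓 X
    have h1 := L0.mk_le_mk.1 (hX (mem_insert _ _))
    have h2 := L0.mk_le_mk.1 (hX (mem_insert_of_mem _ rfl))
    refine L0.mk_le_mk.2 ?_
    filter_upwards [h1, h2] with ω a b using max_le a b

theorem isGLB_minFun (f g : measurableFun Ω) :
    IsGLB {L0.mk 𝔓 f, L0.mk 𝔓 g} (L0.mk 𝔓 (minFun f g)) := by
  constructor
  · rintro X (rfl | rfl)
    · exact L0.mk_le_mk.2 (Eventually.of_forall fun ω => min_le_left _ _)
    · exact L0.mk_le_mk.2 (Eventually.of_forall fun ω => min_le_right _ _)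
  · intro X hX
    obtain ⟨h, rfl⟩ := L0.mk_surjective 𝔓 X
    have h1 := L0.mk_le_mk.1 (hX (mem_insert _ _))
    have h2 := L0.mk_le_mk.1 (hX (mem_insert_of_mem _ rfl))
    refine L0.mk_le_mk.2 ?_
    filter_upwards [h1, h2] with ω a b using le_min a b

/-- A representative of a class in `L⁰_c`. -/
noncomputable def L0.rep (X : L0 𝔓) : measurableFun Ω := (L0.mk_surjective 𝔓 X).choose

theorem L0.mk_rep (X : L0 𝔓) : L0.mk 𝔓 X.rep = X := (L0.mk_surjective 𝔓 X).choose_spec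

/-- Maxima and minima in `L⁰_c` are taken pointwise on representatives. -/
noncomputable instance : Lattice (L0 𝔓) where
  sup X Y := L0.mk 𝔓 (maxFun X.rep Y.rep)
  inf X Y := L0.mk 𝔓 (minFun X.rep Y.rep)
  le_sup_left X Y := by
    have h := (isLUB_maxFun (𝔓 := 𝔓) X.rep Y.rep).1 (mem_insert _ _)
    rwa [L0.mk_rep] at h
  le_sup_right X Y := by
    have h := (isLUB_maxFun (𝔓 := 𝔓) X.rep Y.rep).1 (mem_insert_of_mem _ rfl)
    rwa [L0.mk_rep] at h
  sup_le X Y Z h1 h2 := by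
    refine (isLUB_maxFun (𝔓 := 𝔓) X.rep Y.rep).2 ?_
    simp only [L0.mk_rep]
    rintro W (rfl | rfl) <;> assumption
  inf_le_left X Y := by
    have h := (isGLB_minFun (𝔓 := 𝔓) X.rep Y.rep).1 (mem_insert _ _)
    rwa [L0.mk_rep] at h
  inf_le_right X Y := by
    have h := (isGLB_minFun (𝔓 := 𝔓) X.rep Y.rep).1 (mem_insert_of_mem _ rfl)
    rwa [L0.mk_rep] at h
  le_inf X Y Z h1 h2 := by
    refine (isGLB_minFun (𝔓 := 𝔓) Y.rep Z.rep).2 ?_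
    simp only [L0.mk_rep]
    rintro W (rfl | rfl) <;> assumption

theorem L0.mk_sup (f g : measurableFun Ω) :
    L0.mk 𝔓 f ⊔ L0.mk 𝔓 g = L0.mk 𝔓 (maxFun f g) :=
  isLUB_pair.unique (isLUB_maxFun f g)

theorem L0.mk_inf (f g : measurableFun Ω) :
    L0.mk 𝔓 f ⊓ L0.mk 𝔓 g = L0.mk 𝔓 (minFun f g) :=
  isGLB_pair.unique (isGLB_minFun f g)

instance : IsOrderedAddMonoid (L0 𝔓) where
  add_le_add_left X Y hXY Z := by
    obtain ⟨f, rfl⟩ := L0.mk_surjective 𝔓 X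
    obtain ⟨g, rfl⟩ := L0.mk_surjective 𝔓 Y
    obtain ⟨h, rfl⟩ := L0.mk_surjective 𝔓 Z
    rw [← map_add, ← map_add]
    rw [L0.mk_le_mk] at *
    filter_upwards [hXY] with ω a
    simpa using a

/-- The class of the indicator of an event; the event is given by a measurable set. -/
noncomputable def ind (𝔓 : Set (ProbabilityMeasure Ω)) (A : Set Ω) (hA : MeasurableSet A) : L0 𝔓 :=
  L0.mk 𝔓 ⟨A.indicator fun _ => (1 : ℝ), measurable_const.indicator hA⟩

theorem abs_mk_le_iff (f : measurableFun Ω) (m : ℝ) :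
    |L0.mk 𝔓 f| ≤ m • ind 𝔓 univ MeasurableSet.univ ↔ ∀ᶠ ω in qs 𝔓, |f.1 ω| ≤ m := by
  rw [abs, ← map_neg, L0.mk_sup, ind, ← map_smul, L0.mk_le_mk]
  refine eventually_congr (Eventually.of_forall fun ω => ?_)
  simp [maxFun, abs]

variable (𝔓) in
/-- The space `L^∞_c` of classes `X` in `L⁰_c` with `|X| ≤ m 1_Ω` for some `m > 0`. -/
def Linf : Submodule ℝ (L0 𝔓) where
  carrier := {X | ∃ m : ℝ, 0 < m ∧ |X| ≤ m • ind 𝔓 univ MeasurableSet.univ}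
  add_mem' := by
    rintro X Y ⟨m, hm, hX⟩ ⟨n, hn, hY⟩
    refine ⟨m + n, add_pos hm hn, (abs_add_le X Y).trans ?_⟩
    rw [add_smul]
    exact add_le_add hX hY
  zero_mem' := by
    refine ⟨1, one_pos, ?_⟩
    rw [← map_zero (L0.mk 𝔓), abs_mk_le_iff]
    simp
  smul_mem' := by
    rintro c X ⟨m, hm, hX⟩
    obtain ⟨f, rfl⟩ := L0.mk_surjective 𝔓 X
    refine ⟨(|c| + 1) * m, by positivity, ?_⟩
    rw [← map_smul, abs_mk_le_iff]
    rw [abs_mk_le_iff] at hX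
    filter_upwards [hX] with ω a
    change |c * f.1 ω| ≤ _
    rw [abs_mul]
    gcongr
    linarith

theorem mk_mem_Linf (f : measurableFun Ω) :
    L0.mk 𝔓 f ∈ Linf 𝔓 ↔ ∃ m : ℝ, 0 < m ∧ ∀ᶠ ω in qs 𝔓, |f.1 ω| ≤ m := by
  change (∃ m : ℝ, 0 < m ∧ |L0.mk 𝔓 f| ≤ m • ind 𝔓 univ MeasurableSet.univ) ↔ _
  simp only [abs_mk_le_iff]

theorem sup_inf_mem_Linf {X Y : L0 𝔓} (hX : X ∈ Linf 𝔓) (hY : Y ∈ Linf 𝔓) :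
    X ⊔ Y ∈ Linf 𝔓 ∧ X ⊓ Y ∈ Linf 𝔓 := by
  obtain ⟨f, rfl⟩ := L0.mk_surjective 𝔓 X
  obtain ⟨g, rfl⟩ := L0.mk_surjective 𝔓 Y
  rw [L0.mk_sup, L0.mk_inf]
  simp only [mk_mem_Linf] at *
  obtain ⟨m, hm, h1⟩ := hX
  obtain ⟨n, hn, h2⟩ := hY
  refine ⟨⟨max m n, lt_max_of_lt_left hm, ?_⟩, ⟨max m n, lt_max_of_lt_left hm, ?_⟩⟩
  · filter_upwards [h1, h2] with ω a b
    exact (abs_max_le_max_abs_abs).trans (max_le_max a b)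
  · filter_upwards [h1, h2] with ω a b
    exact (abs_min_le_max_abs_abs).trans (max_le_max a b)

/-- `L^∞_c` is a vector sublattice of `L⁰_c`. -/
noncomputable instance : Lattice (Linf 𝔓) :=
  Subtype.lattice (fun _ _ hX hY => (sup_inf_mem_Linf hX hY).1)
    (fun _ _ hX hY => (sup_inf_mem_Linf hX hY).2)

end FunctionSpaces

section Pairing

variable {Ω : Type u} [MeasurableSpace Ω]

/-- The integral of a random variable with respect to a finite signed measure. -/
noncomputable def signedIntegral (f : Ω → ℝ) (μ : SignedMeasure Ω) : ℝ :=
  ∫ ω, f ω ∂μ.toJordanDecomposition.posPart - ∫ ω, f ω ∂μ.toJordanDecomposition.negPart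

/-- The pairing `∫ X dμ` of `X ∈ L^∞_c` and `μ ∈ ca_c`; it does not depend on the representative
of `X`, see `pairing_eq`. -/
noncomputable def pairing {𝔓 : Set (ProbabilityMeasure Ω)} (X : Linf 𝔓) (μ : SignedMeasure Ω) : ℝ :=
  signedIntegral X.1.rep.1 μ

theorem totalVariation_toSignedMeasure (μ : Measure Ω) [IsFiniteMeasure μ] :
    μ.toSignedMeasure.totalVariation = μ := by
  have h : μ.toSignedMeasure.toJordanDecomposition =
      ⟨μ, 0, Measure.MutuallySingular.zero_right⟩ :=
    SignedMeasure.toJordanDecomposition_eq (by simp [JordanDecomposition.toSignedMeasure])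
  simp [SignedMeasure.totalVariation, h]

theorem totalVariation_eq_zero_of_isPolar {𝔓 : Set (ProbabilityMeasure Ω)} {μ : SignedMeasure Ω}
    (hμ : μ ∈ ca 𝔓) {N : Set Ω} (hN : IsPolar 𝔓 N) : μ.totalVariation N = 0 := by
  have h := hμ N hN.1 ?_
  · simpa using h
  · have h0 := hN.2
    simp only [upperProb, ENNReal.iSup_eq_zero] at h0 ⊢
    rintro _ ⟨P, hP, rfl⟩
    simpa [totalVariation_toSignedMeasure] using h0 P hP

theorem pairing_eq {𝔓 : Set (ProbabilityMeasure Ω)} {μ : SignedMeasure Ω} (hμ : μ ∈ ca 𝔓)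
    (X : Linf 𝔓) (f : measurableFun Ω) (hf : L0.mk 𝔓 f = X.1) :
    pairing X μ = signedIntegral f.1 μ := by
  have h : ∀ᶠ ω in qs 𝔓, X.1.rep.1 ω = f.1 ω := L0.mk_eq_mk.1 (by rw [L0.mk_rep, hf])
  obtain ⟨N, hN, hsub⟩ := h
  have h0 := totalVariation_eq_zero_of_isPolar hμ hN
  have hle : {ω | ¬ X.1.rep.1 ω = f.1 ω} ⊆ N := fun ω hω => by
    by_contra hn
    exact hω (hsub hn)
  simp only [SignedMeasure.totalVariation, Measure.coe_add, Pi.add_apply, add_eq_zero] at h0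
  unfold pairing signedIntegral
  congr 1
  · exact integral_congr_ae (measure_mono_null hle h0.1)
  · exact integral_congr_ae (measure_mono_null hle h0.2)

/-- The weak topology `σ(L^∞_c, M)` for a set `M` of measures in `ca_c`: the coarsest topology for
which `X ↦ ∫ X dμ` is continuous for every `μ ∈ M`. -/
@[reducible] noncomputable def weakTopology (𝔓 : Set (ProbabilityMeasure Ω)) (M : Set (SignedMeasure Ω)) :
    TopologicalSpace (Linf 𝔓) :=
  ⨅ μ ∈ M, TopologicalSpace.induced (fun X : Linf 𝔓 => pairing X μ) inferInstance

end Pairing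

section OrderClosed

variable {E : Type u} [Lattice E] [AddCommGroup E]

/-- Order convergence of a net `x` to `a`: `|x i - a| ≤ y i` for some decreasing net `y` over the
same index set with infimum `0`. -/
def OrderConverges {I : Type u} [Preorder I] (x : I → E) (a : E) : Prop :=
  ∃ y : I → E, Antitone y ∧ IsGLB (range y) 0 ∧ ∀ i, |x i - a| ≤ y i

/-- A set is order closed if it contains all order limits of nets in it. Index sets in the universe
of the space suffice: a net `x` with regulator `y` can be re-indexed by the set of its pairs
`(x i, y i)`, ordered by decreasing second component. -/
def OrderClosed (C : Set E) : Prop :=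
  ∀ (I : Type u) [Preorder I] [IsDirectedOrder I] [Nonempty I] (x : I → E) (a : E),
    (∀ i, x i ∈ C) → OrderConverges x a → a ∈ C

end OrderClosed

end QuasiSure

namespace QuasiSure

variable {Ω : Type u} [MeasurableSpace Ω] {𝔓 : Set (ProbabilityMeasure Ω)}

/-! ### Polar events and measures vanishing on them -/

section Polar

/-! A support `S` of `m` upgrades `m`-almost sure statements to quasi-sure statements on `S`. Hence
integration against a supported measure is order continuous: along a net decreasing to `0`, a
minimising sequence has an infimum that is `m`-a.e. below every member; restricted to `S` it is a
q.s. lower bound, hence null. So sets closed for measures in `sca` are order closed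
(`orderClosed_of_isClosed`).

Conversely, under class (S) the restrictions of `X` to supports order converge to `X`, so one
support `S` of a finite `m` can be treated at a time. If `X` restricted to `S` is outside an order
closed convex solid `C`, then `X` is outside the `L²(m)`-closure of `C`, because an `L²`-limit is an
a.e. limit of a subsequence and solidity turns this into an order limit on `S`. Hahn–Banach and
Riesz in `L²(m)` give a separating density, and a measure with a density with respect to `m` is
again supported (`exists_separating_sca`).

For the converses, test sets suffice. In (1), `{0}` closed means that `sca` separates points, so
normalised moduli of measures in `sca` detect every non-polar event. In (2), the `L¹(|μ|)`-balls are
weakly closed for `ca`, hence order closed; if `|μ|` had no support, small functions in such a ball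
would order converge to `1`, which lies outside (`supported_of_orderClosed_l1Ball`). -/

theorem IsPolar.mono {A B : Set Ω} (hB : IsPolar 𝔓 B) (hA : MeasurableSet A) (h : A ⊆ B) :
    IsPolar 𝔓 A := by
  refine ⟨hA, ?_⟩
  have h0 := hB.2
  simp only [upperProb, ENNReal.iSup_eq_zero] at h0 ⊢
  exact fun P hP => measure_mono_null h (h0 P hP)

theorem isPolar_iUnion {ι : Type*} [Countable ι] {A : ι → Set Ω} (hA : ∀ i, IsPolar 𝔓 (A i)) :
    IsPolar 𝔓 (⋃ i, A i) := by
  refine ⟨MeasurableSet.iUnion fun i => (hA i).1, ?_⟩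
  have h0 := fun i => (hA i).2
  simp only [upperProb, ENNReal.iSup_eq_zero] at h0 ⊢
  exact fun P hP => measure_iUnion_null fun i => h0 i P hP

theorem isPolar_empty : IsPolar 𝔓 (∅ : Set Ω) := ⟨MeasurableSet.empty, by simp [upperProb]⟩

theorem IsPolar.union {A B : Set Ω} (hA : IsPolar 𝔓 A) (hB : IsPolar 𝔓 B) :
    IsPolar 𝔓 (A ∪ B) := by
  rw [union_eq_iUnion]
  exact isPolar_iUnion fun b => by cases b <;> assumption

instance : CountableInterFilter (qs 𝔓) := by
  refine ⟨fun S hS h => ?_⟩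
  choose! N hN hsub using h
  have := hS.to_subtype
  refine ⟨⋃ s : S, N s, isPolar_iUnion fun s => hN s s.2, ?_⟩
  intro ω hω s hs
  refine hsub s hs fun hmem => hω (mem_iUnion.2 ⟨⟨s, hs⟩, hmem⟩)

/-- A measure is dominated by the upper probability if it vanishes on polar events. -/
def DominatedMeasure (𝔓 : Set (ProbabilityMeasure Ω)) (m : Measure Ω) : Prop :=
  ∀ N, IsPolar 𝔓 N → m N = 0

theorem DominatedMeasure.ae_le_qs {m : Measure Ω} (hm : DominatedMeasure 𝔓 m) :
    ae m ≤ qs 𝔓 := by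
  rintro s ⟨N, hN, h⟩
  exact mem_of_superset (compl_mem_ae_iff.2 (hm N hN)) h

theorem DominatedMeasure.add {m n : Measure Ω} (hm : DominatedMeasure 𝔓 m)
    (hn : DominatedMeasure 𝔓 n) : DominatedMeasure 𝔓 (m + n) :=
  fun N hN => by simp [hm N hN, hn N hN]

theorem DominatedMeasure.of_ac {m n : Measure Ω} (hm : DominatedMeasure 𝔓 m) (h : n ≪ m) :
    DominatedMeasure 𝔓 n := fun N hN => h (hm N hN)

theorem mem_ca_iff {μ : SignedMeasure Ω} :
    μ ∈ ca 𝔓 ↔ DominatedMeasure 𝔓 μ.totalVariation := by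
  refine ⟨fun h N hN => totalVariation_eq_zero_of_isPolar h hN, fun h N hN h0 => ?_⟩
  have hp : IsPolar 𝔓 N := by
    refine ⟨hN, ?_⟩
    simp only [upperProb, ENNReal.iSup_eq_zero] at h0 ⊢
    intro P hP
    simpa [totalVariation_toSignedMeasure] using h0 _ ⟨P, hP, rfl⟩
  simpa using h N hp

theorem dominatedMeasure_of_mem {P : ProbabilityMeasure Ω} (hP : P ∈ 𝔓) :
    DominatedMeasure 𝔓 (P : Measure Ω) := by
  intro N hN
  have h0 := hN.2
  simp only [upperProb, ENNReal.iSup_eq_zero] at h0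
  exact h0 P hP

theorem isPolar_iff {N : Set Ω} :
    IsPolar 𝔓 N ↔ MeasurableSet N ∧ ∀ P ∈ 𝔓, (P : Measure Ω) N = 0 := by
  simp only [IsPolar, upperProb, ENNReal.iSup_eq_zero]

theorem equivalent_iff {𝔔 : Set (ProbabilityMeasure Ω)} :
    Equivalent 𝔔 𝔓 ↔ ∀ N, IsPolar 𝔔 N ↔ IsPolar 𝔓 N := by
  have key : ∀ 𝔗 : Set (ProbabilityMeasure Ω), ∀ N,
      (⨆ ν ∈ asSigned 𝔗, ν.totalVariation N) = upperProb 𝔗 N := by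
    intro 𝔗 N
    simp only [asSigned, iSup_image, totalVariation_toSignedMeasure, upperProb]
  simp only [Equivalent, Dominated, key, IsPolar]
  constructor
  · rintro ⟨h1, h2⟩ N
    exact ⟨fun h => ⟨h.1, h2 N h.1 h.2⟩, fun h => ⟨h.1, h1 N h.1 h.2⟩⟩
  · intro h
    exact ⟨fun N hN h0 => ((h N).2 ⟨hN, h0⟩).2, fun N hN h0 => ((h N).1 ⟨hN, h0⟩).2⟩

end Polar

/-! ### Supports of measures -/

section Support

/-- `S` is an event carrying `m` all of whose `m`-null sub-events are polar. -/
def IsSupport (𝔓 : Set (ProbabilityMeasure Ω)) (m : Measure Ω) (S : Set Ω) : Prop :=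
  MeasurableSet S ∧ m Sᶜ = 0 ∧
    ∀ N : Set Ω, MeasurableSet N → m (N ∩ S) = 0 → IsPolar 𝔓 (N ∩ S)

variable {m n : Measure Ω} {S T : Set Ω}

/-- The exceptional null set meets `S` in a polar event. This is how supports enter all later
arguments. -/
theorem IsSupport.eventually (hS : IsSupport 𝔓 m S) {p : Ω → Prop} (hp : ∀ᵐ ω ∂m, p ω) :
    ∀ᶠ ω in qs 𝔓, ω ∈ S → p ω := by
  obtain ⟨N, hN, hNm, hN0⟩ := exists_measurable_superset_of_null (ae_iff.1 hp)
  refine ⟨N ∩ S, hS.2.2 N hNm (measure_mono_null inter_subset_left hN0), fun ω hω hωS => ?_⟩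
  by_contra h
  exact hω ⟨hN h, hωS⟩

theorem IsSupport.add (hS : IsSupport 𝔓 m S) (hT : IsSupport 𝔓 n T) :
    IsSupport 𝔓 (m + n) (S ∪ T) := by
  refine ⟨hS.1.union hT.1, ?_, fun N hN h => ?_⟩
  · rw [Measure.coe_add, Pi.add_apply, compl_union, measure_mono_null inter_subset_left hS.2.1,
      measure_mono_null inter_subset_right hT.2.1, add_zero]
  · rw [Measure.coe_add, Pi.add_apply, add_eq_zero] at h
    rw [inter_union_distrib_left] at h ⊢
    exact (hS.2.2 N hN (measure_mono_null subset_union_left h.1)).union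
      (hT.2.2 N hN (measure_mono_null subset_union_right h.2))

/-- A measure with a density with respect to a supported measure is supported. -/
theorem IsSupport.withDensity (hS : IsSupport 𝔓 m S) {h : Ω → ℝ≥0∞} (hh : Measurable h) :
    IsSupport 𝔓 (m.withDensity h) (S ∩ {ω | h ω ≠ 0}) := by
  have hH : MeasurableSet {ω | h ω ≠ 0} := (hh (measurableSet_singleton 0)).compl
  refine ⟨hS.1.inter hH, ?_, fun N hN h0 => ?_⟩
  · rw [compl_inter]
    refine measure_union_null (withDensity_absolutelyContinuous m h hS.2.1) ?_
    rw [withDensity_apply_eq_zero hh]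
    refine measure_mono_null (t := ∅) ?_ measure_empty
    rintro ω ⟨h1, h2⟩
    exact h2 h1
  · rw [withDensity_apply_eq_zero hh] at h0
    have e : N ∩ (S ∩ {ω | h ω ≠ 0}) = ({ω | h ω ≠ 0} ∩ N) ∩ S := by
      ext ω
      simp only [mem_inter_iff]
      tauto
    rw [e]
    refine hS.2.2 _ (hH.inter hN) (measure_mono_null ?_ h0)
    rintro ω ⟨⟨h1, h2⟩, h3⟩
    exact ⟨h1, h2, h3, h1⟩

end Support

/-! ### Signed measures with a density -/

section Density

/-- The signed measure with density `h` with respect to a finite measure. -/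
theorem exists_signedMeasure_density {m : Measure Ω} {h : Ω → ℝ} (hh : Measurable h)
    (hi : Integrable h m) :
    ∃ μ : SignedMeasure Ω, μ.totalVariation = m.withDensity (fun ω => ENNReal.ofReal |h ω|) ∧
      ∀ f : Ω → ℝ, Integrable (fun ω => h ω * f ω) m →
        signedIntegral f μ = ∫ ω, h ω * f ω ∂m := by
  have := isFiniteMeasure_withDensity_ofReal hi.2
  have := isFiniteMeasure_withDensity_ofReal hi.neg.2
  have hsing : m.withDensity (fun ω => ENNReal.ofReal (h ω)) ⟂ₘ
      m.withDensity (fun ω => ENNReal.ofReal ((-h) ω)) := by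
    refine ⟨{ω | h ω ≤ 0}, hh measurableSet_Iic, ?_, ?_⟩
    · rw [withDensity_apply_eq_zero hh.ennreal_ofReal]
      refine measure_mono_null (t := ∅) ?_ measure_empty
      rintro ω ⟨h1, h2⟩
      exact h1 (ENNReal.ofReal_eq_zero.2 h2)
    · rw [withDensity_apply_eq_zero hh.neg.ennreal_ofReal]
      refine measure_mono_null (t := ∅) ?_ measure_empty
      rintro ω ⟨h1, h2⟩
      refine h1 (ENNReal.ofReal_eq_zero.2 ?_)
      simpa using (not_le.1 (show ¬ h ω ≤ 0 from h2)).le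
  refine ⟨JordanDecomposition.toSignedMeasure ⟨_, _, hsing⟩, ?_, ?_⟩
  · rw [SignedMeasure.totalVariation, JordanDecomposition.toJordanDecomposition_toSignedMeasure,
      ← withDensity_add_left hh.ennreal_ofReal]
    congr 1
    funext ω
    rcases le_total 0 (h ω) with h0 | h0
    · simp [abs_of_nonneg h0, h0]
    · simp [abs_of_nonpos h0, h0]
  · intro f hf
    rw [signedIntegral, JordanDecomposition.toJordanDecomposition_toSignedMeasure]
    change ∫ ω, f ω ∂(m.withDensity fun ω => ENNReal.ofReal (h ω)) -
      ∫ ω, f ω ∂(m.withDensity fun ω => ENNReal.ofReal ((-h) ω)) = _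
    rw [integral_withDensity_eq_integral_toReal_smul hh.ennreal_ofReal (by simp),
      integral_withDensity_eq_integral_toReal_smul hh.neg.ennreal_ofReal (by simp), ← integral_sub]
    · refine integral_congr_ae (Eventually.of_forall fun ω => ?_)
      simp only [ENNReal.toReal_ofReal', smul_eq_mul, Pi.neg_apply]
      rcases le_total 0 (h ω) with h0 | h0
      · simp [h0]
      · simp [h0]
    -- The positive part of `h` times `f` is `h * f` cut off to `{0 ≤ h}`, so integrability of the
    -- product is enough.
    · refine (hf.indicator (measurableSet_le (measurable_const (a := (0 : ℝ))) hh)).congr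
        (Eventually.of_forall fun ω => ?_)
      change indicator {ω | 0 ≤ h ω} _ ω = _
      simp only [ENNReal.toReal_ofReal', smul_eq_mul, indicator, mem_ofPred_eq]
      split_ifs with h0
      · rw [max_eq_left h0]
      · rw [max_eq_right (not_le.1 h0).le, zero_mul]
    · refine (hf.neg.indicator (measurableSet_le hh (measurable_const (a := (0 : ℝ))))).congr
        (Eventually.of_forall fun ω => ?_)
      change indicator {ω | h ω ≤ 0} _ ω = _
      simp only [ENNReal.toReal_ofReal', smul_eq_mul, indicator, mem_ofPred_eq, Pi.neg_apply]
      split_ifs with h0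
      · rw [max_eq_left (by linarith), neg_mul]
      · rw [max_eq_right (by linarith), zero_mul]

end Density

/-- A representative of a class in `L^∞_c`. -/
noncomputable def rv (X : Linf 𝔓) : Ω → ℝ := X.1.rep.1

/-! ### Quasi-sure calculus with representatives -/

namespace Linf

theorem measurable_rv (X : Linf 𝔓) : Measurable (rv X) := X.1.rep.2

/-- The class of a bounded random variable. -/
noncomputable def of (𝔓 : Set (ProbabilityMeasure Ω)) (f : Ω → ℝ) (hf : Measurable f)
    (hb : ∃ r : ℝ, ∀ᶠ ω in qs 𝔓, |f ω| ≤ r) : Linf 𝔓 :=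
  ⟨L0.mk 𝔓 ⟨f, hf⟩, by
    obtain ⟨r, hr⟩ := hb
    refine (mk_mem_Linf _).2 ⟨max r 1, by positivity, ?_⟩
    filter_upwards [hr] with ω h using h.trans (le_max_left _ _)⟩

theorem rv_eq_of_mk {X : Linf 𝔓} {f : measurableFun Ω} (h : X.1 = L0.mk 𝔓 f) :
    rv X =ᶠ[qs 𝔓] f.1 :=
  L0.mk_eq_mk.1 ((L0.mk_rep X.1).trans h)

theorem rv_of {f : Ω → ℝ} (hf : Measurable f) (hb : ∃ r : ℝ, ∀ᶠ ω in qs 𝔓, |f ω| ≤ r) :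
    rv (of 𝔓 f hf hb) =ᶠ[qs 𝔓] f :=
  rv_eq_of_mk (f := ⟨f, hf⟩) rfl

theorem exists_bound (X : Linf 𝔓) : ∃ r : ℝ, 0 < r ∧ ∀ᶠ ω in qs 𝔓, |rv X ω| ≤ r := by
  have h := X.2
  rw [← L0.mk_rep X.1, mk_mem_Linf] at h
  exact h

theorem le_iff {X Y : Linf 𝔓} : X ≤ Y ↔ rv X ≤ᶠ[qs 𝔓] rv Y := by
  change X.1 ≤ Y.1 ↔ _
  rw [← L0.mk_rep X.1, ← L0.mk_rep Y.1, L0.mk_le_mk]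
  rfl

theorem eq_iff {X Y : Linf 𝔓} : X = Y ↔ rv X =ᶠ[qs 𝔓] rv Y := by
  constructor
  · rintro rfl
    rfl
  · intro h
    exact le_antisymm (le_iff.2 h.le) (le_iff.2 h.symm.le)

theorem rv_add (X Y : Linf 𝔓) : rv (X + Y) =ᶠ[qs 𝔓] fun ω => rv X ω + rv Y ω :=
  rv_eq_of_mk (f := X.1.rep + Y.1.rep) (by simp [L0.mk_rep])

theorem rv_smul (c : ℝ) (X : Linf 𝔓) : rv (c • X) =ᶠ[qs 𝔓] fun ω => c * rv X ω :=
  rv_eq_of_mk (f := c • X.1.rep) (by simp [L0.mk_rep])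

theorem rv_zero : rv (0 : Linf 𝔓) =ᶠ[qs 𝔓] fun _ => 0 :=
  rv_eq_of_mk (f := 0) (by simp)

theorem rv_sub (X Y : Linf 𝔓) : rv (X - Y) =ᶠ[qs 𝔓] fun ω => rv X ω - rv Y ω :=
  rv_eq_of_mk (f := X.1.rep - Y.1.rep) (by simp [L0.mk_rep])

theorem rv_abs (X : Linf 𝔓) : rv |X| =ᶠ[qs 𝔓] fun ω => |rv X ω| := by
  refine rv_eq_of_mk (f := maxFun X.1.rep (-X.1.rep)) ?_
  rw [← L0.mk_sup, map_neg, L0.mk_rep]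
  rfl

theorem abs_le_abs_iff {X Y : Linf 𝔓} : |X| ≤ |Y| ↔ ∀ᶠ ω in qs 𝔓, |rv X ω| ≤ |rv Y ω| := by
  rw [le_iff]
  refine eventually_congr ?_
  filter_upwards [rv_abs X, rv_abs Y] with ω h1 h2
  rw [h1, h2]

theorem abs_sub_le_iff {X Y Z : Linf 𝔓} :
    |X - Y| ≤ Z ↔ ∀ᶠ ω in qs 𝔓, |rv X ω - rv Y ω| ≤ rv Z ω := by
  rw [le_iff]
  refine eventually_congr ?_
  filter_upwards [rv_abs (X - Y), rv_sub X Y] with ω h1 h2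
  rw [h1, h2]

theorem nonneg_iff {X : Linf 𝔓} : 0 ≤ X ↔ ∀ᶠ ω in qs 𝔓, 0 ≤ rv X ω := by
  rw [le_iff]
  refine eventually_congr ?_
  filter_upwards [rv_zero (𝔓 := 𝔓)] with ω h1
  rw [h1]

theorem nonpos_iff {X : Linf 𝔓} : X ≤ 0 ↔ ∀ᶠ ω in qs 𝔓, rv X ω ≤ 0 := by
  rw [le_iff]
  refine eventually_congr ?_
  filter_upwards [rv_zero (𝔓 := 𝔓)] with ω h1
  rw [h1]

variable {m : Measure Ω}

theorem exists_ae_bound (hm : DominatedMeasure 𝔓 m) (X : Linf 𝔓) :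
    ∃ r : ℝ, 0 < r ∧ ∀ᵐ ω ∂m, |rv X ω| ≤ r := by
  obtain ⟨r, hr, h⟩ := (exists_bound X)
  exact ⟨r, hr, hm.ae_le_qs h⟩

theorem memLp [IsFiniteMeasure m] (hm : DominatedMeasure 𝔓 m) (X : Linf 𝔓) (p : ℝ≥0∞) :
    MemLp (rv X) p m := by
  obtain ⟨r, _, h⟩ := exists_ae_bound hm X
  exact MemLp.of_bound (measurable_rv X).aestronglyMeasurable r h

theorem integrable [IsFiniteMeasure m] (hm : DominatedMeasure 𝔓 m) (X : Linf 𝔓) :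
    Integrable (rv X) m :=
  (memLp hm X 1).integrable le_rfl

theorem integrable_mul (hm : DominatedMeasure 𝔓 m) {h : Ω → ℝ} (hh : Integrable h m)
    (X : Linf 𝔓) : Integrable (fun ω => h ω * rv X ω) m := by
  obtain ⟨r, _, hr⟩ := exists_ae_bound hm X
  exact hh.mul_bdd (measurable_rv X).aestronglyMeasurable hr

end Linf

/-! ### Pairing and weak topologies -/

theorem pairing_def (X : Linf 𝔓) (μ : SignedMeasure Ω) : pairing X μ = signedIntegral (rv X) μ := rfl

theorem DominatedMeasure.posPart {μ : SignedMeasure Ω} (hμ : μ ∈ ca 𝔓) :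
    DominatedMeasure 𝔓 μ.toJordanDecomposition.posPart := by
  intro N hN
  have h := mem_ca_iff.1 hμ N hN
  simp only [SignedMeasure.totalVariation, Measure.coe_add, Pi.add_apply, add_eq_zero] at h
  exact h.1

theorem DominatedMeasure.negPart {μ : SignedMeasure Ω} (hμ : μ ∈ ca 𝔓) :
    DominatedMeasure 𝔓 μ.toJordanDecomposition.negPart := by
  intro N hN
  have h := mem_ca_iff.1 hμ N hN
  simp only [SignedMeasure.totalVariation, Measure.coe_add, Pi.add_apply, add_eq_zero] at h
  exact h.2

instance (μ : SignedMeasure Ω) : IsFiniteMeasure μ.totalVariation := by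
  unfold SignedMeasure.totalVariation
  infer_instance

theorem abs_pairing_sub_le {μ : SignedMeasure Ω} (hμ : μ ∈ ca 𝔓) {X Y Z : Linf 𝔓}
    (h : |X - Y| ≤ Z) : |pairing X μ - pairing Y μ| ≤ ∫ ω, rv Z ω ∂μ.totalVariation := by
  have hp := DominatedMeasure.posPart hμ
  have hn := DominatedMeasure.negPart hμ
  have h' := Linf.abs_sub_le_iff.1 h
  rw [SignedMeasure.totalVariation, integral_add_measure (Linf.integrable hp Z) (Linf.integrable hn Z),
    pairing_def, pairing_def, signedIntegral, signedIntegral]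
  have e1 : |∫ ω, rv X ω ∂μ.toJordanDecomposition.posPart -
      ∫ ω, rv Y ω ∂μ.toJordanDecomposition.posPart| ≤
      ∫ ω, rv Z ω ∂μ.toJordanDecomposition.posPart := by
    rw [← integral_sub (Linf.integrable hp X) (Linf.integrable hp Y)]
    exact norm_integral_le_of_norm_le (f := fun ω => rv X ω - rv Y ω) (Linf.integrable hp Z)
      (Eventually.filter_mono hp.ae_le_qs h')
  have e2 : |∫ ω, rv X ω ∂μ.toJordanDecomposition.negPart -
      ∫ ω, rv Y ω ∂μ.toJordanDecomposition.negPart| ≤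
      ∫ ω, rv Z ω ∂μ.toJordanDecomposition.negPart := by
    rw [← integral_sub (Linf.integrable hn X) (Linf.integrable hn Y)]
    exact norm_integral_le_of_norm_le (f := fun ω => rv X ω - rv Y ω) (Linf.integrable hn Z)
      (Eventually.filter_mono hn.ae_le_qs h')
  rw [abs_le] at *
  constructor <;> linarith [e1.1, e1.2, e2.1, e2.2]

theorem continuous_pairing {M : Set (SignedMeasure Ω)} {μ : SignedMeasure Ω} (hμ : μ ∈ M) :
    Continuous[weakTopology 𝔓 M, inferInstance] fun X : Linf 𝔓 => pairing X μ := by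
  rw [continuous_iff_le_induced]
  exact iInf₂_le μ hμ

theorem tendsto_weakTopology {M : Set (SignedMeasure Ω)} {ι : Type*} {l : Filter ι}
    {x : ι → Linf 𝔓} {a : Linf 𝔓}
    (h : ∀ μ ∈ M, Tendsto (fun i => pairing (x i) μ) l (𝓝 (pairing a μ))) :
    Tendsto x l (@nhds _ (weakTopology 𝔓 M) a) := by
  simp only [nhds_iInf, nhds_induced, tendsto_iInf, tendsto_comap_iff]
  exact h

/-! ### Order continuity of supported measures -/

section OrderContinuity

/-- Integration against a finite supported measure is order continuous. -/
theorem exists_integral_lt_of_isGLB {m : Measure Ω} [IsFiniteMeasure m]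
    (hm : DominatedMeasure 𝔓 m) {S : Set Ω} (hS : IsSupport 𝔓 m S) {I : Type*} [Preorder I]
    [IsDirectedOrder I] [Nonempty I] {y : I → Linf 𝔓} (hy : Antitone y)
    (h0 : IsGLB (range y) 0) {ε : ℝ} (hε : 0 < ε) : ∃ i, ∫ ω, rv (y i) ω ∂m < ε := by
  by_contra! hcon
  have hnn : ∀ i, ∀ᶠ ω in qs 𝔓, 0 ≤ rv (y i) ω := fun i => Linf.nonneg_iff.1 (h0.1 ⟨i, rfl⟩)
  have hmono : ∀ i j, i ≤ j → ∀ᶠ ω in qs 𝔓, rv (y j) ω ≤ rv (y i) ω :=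
    fun i j hij => Linf.le_iff.1 (hy hij)
  have hint : ∀ i, Integrable (rv (y i)) m := fun i => Linf.integrable hm _
  set c : ℝ := ⨅ i, ∫ ω, rv (y i) ω ∂m with hc
  have hbdd : BddBelow (range fun i => ∫ ω, rv (y i) ω ∂m) :=
    ⟨ε, by rintro _ ⟨i, rfl⟩; exact hcon i⟩
  have hcε : ε ≤ c := le_ciInf hcon
  have hcle : ∀ i, c ≤ ∫ ω, rv (y i) ω ∂m := fun i => ciInf_le hbdd i
  have hlt : ∀ n : ℕ, ∃ i, ∫ ω, rv (y i) ω ∂m < c + 1 / ((n : ℝ) + 1) := fun n =>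
    exists_lt_of_ciInf_lt (lt_add_of_pos_right c Nat.one_div_pos_of_nat)
  choose a ha using hlt
  choose sup hsupl hsupr using fun i j : I => directed_of (· ≤ ·) i j
  -- The near-minimisers `a n` need not be increasing; successive upper bounds are, and their
  -- integrals stay within `1 / (n + 1)` of the infimum `c`.
  let s : ℕ → I := fun n => Nat.rec (a 0) (fun k i => sup i (a (k + 1))) n
  have hs : Monotone s := monotone_nat_of_le_succ fun n => hsupl _ _
  have has : ∀ n, a n ≤ s n := by
    rintro (_ | n)
    · exact le_rfl
    · exact hsupr _ _
  have hsint : ∀ n : ℕ, ∫ ω, rv (y (s n)) ω ∂m < c + 1 / ((n : ℝ) + 1) := fun n =>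
    lt_of_le_of_lt (integral_mono_ae (hint _) (hint _) (hm.ae_le_qs (hmono _ _ (has n)))) (ha n)
  -- The absolute value changes nothing quasi surely and makes the real infimum bounded below at
  -- every point.
  let G : Ω → ℝ := fun ω => ⨅ n, |rv (y (s n)) ω|
  have hGm : Measurable G := Measurable.iInf fun n => (Linf.measurable_rv _).abs
  have hbd : ∀ ω, BddBelow (range fun n => |rv (y (s n)) ω|) := fun ω =>
    ⟨0, by rintro _ ⟨n, rfl⟩; exact abs_nonneg _⟩
  have hG0 : ∀ ω, 0 ≤ G ω := fun ω => le_ciInf fun n => abs_nonneg _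
  have hGle : ∀ n, ∀ᶠ ω in qs 𝔓, G ω ≤ rv (y (s n)) ω := by
    intro n
    filter_upwards [hnn (s n)] with ω h
    exact (ciInf_le (hbd ω) n).trans (abs_of_nonneg h).le
  have hGi : Integrable G m := (hint (s 0)).mono' hGm.aestronglyMeasurable <| by
    filter_upwards [hm.ae_le_qs (hGle 0)] with ω h
    rwa [Real.norm_of_nonneg (hG0 ω)]
  -- An index above both `s n` and `j` has integral at least `c`, while `s n` exceeds `c` by less
  -- than `1 / (n + 1)`; this difference bounds the integral of the positive part of `G - y j`.
  have hGy : ∀ j, ∀ᵐ ω ∂m, G ω ≤ rv (y j) ω := by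
    intro j
    have hpos : Integrable (fun ω => max (G ω - rv (y j) ω) 0) m := (hGi.sub (hint j)).pos_part
    have hle : ∀ n : ℕ, ∫ ω, max (G ω - rv (y j) ω) 0 ∂m ≤ 1 / ((n : ℝ) + 1) := by
      intro n
      have h1 : ∫ ω, max (G ω - rv (y j) ω) 0 ∂m ≤
          ∫ ω, (rv (y (s n)) ω - rv (y (sup (s n) j)) ω) ∂m := by
        refine integral_mono_ae hpos ((hint _).sub (hint _)) ?_
        filter_upwards [hm.ae_le_qs (hGle n), hm.ae_le_qs (hmono _ _ (hsupl (s n) j)),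
          hm.ae_le_qs (hmono _ _ (hsupr (s n) j))] with ω h1 h2 h3
        exact max_le (by linarith) (by linarith)
      rw [integral_sub (hint _) (hint _)] at h1
      linarith [hcle (sup (s n) j), hsint n]
    have hzero : ∫ ω, max (G ω - rv (y j) ω) 0 ∂m = 0 :=
      le_antisymm (ge_of_tendsto' tendsto_one_div_add_atTop_nhds_zero_nat hle)
        (integral_nonneg fun ω => le_max_right _ _)
    filter_upwards [(integral_eq_zero_iff_of_nonneg (fun ω => le_max_right _ _) hpos).1 hzero] with ω h
    have : G ω - rv (y j) ω ≤ 0 := max_eq_right_iff.1 h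
    linarith
  have hbound : ∃ r : ℝ, ∀ᶠ ω in qs 𝔓, |S.indicator G ω| ≤ r := by
    obtain ⟨r, hr, h⟩ := Linf.exists_bound (y (s 0))
    refine ⟨r, ?_⟩
    filter_upwards [h, hGle 0] with ω h1 h2
    by_cases hω : ω ∈ S
    · rw [indicator_of_mem hω, abs_of_nonneg (hG0 ω)]
      exact h2.trans ((le_abs_self _).trans h1)
    · rw [indicator_of_notMem hω, abs_zero]
      exact hr.le
  -- On `S` the a.e. bound by each `y j` holds q.s., even though the net is uncountable: being a
  -- lower bound is tested one index at a time.
  have hlow : Linf.of 𝔓 _ (hGm.indicator hS.1) hbound ≤ 0 := by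
    refine h0.2 ?_
    rintro _ ⟨j, rfl⟩
    refine Linf.le_iff.2 ?_
    filter_upwards [Linf.rv_of (hGm.indicator hS.1) hbound, hS.eventually (hGy j), hnn j]
      with ω h1 h2 h3
    rw [h1]
    by_cases hω : ω ∈ S
    · rw [indicator_of_mem hω]
      exact h2 hω
    · rwa [indicator_of_notMem hω]
  have hGnull : ∀ᵐ ω ∂m, G ω = 0 := by
    have hSae : ∀ᵐ ω ∂m, ω ∈ S := hS.2.1
    filter_upwards [hSae, hm.ae_le_qs (Linf.nonpos_iff.1 hlow),
      hm.ae_le_qs (Linf.rv_of (hGm.indicator hS.1) hbound)] with ω h1 h2 h3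
    rw [h3, indicator_of_mem h1] at h2
    exact le_antisymm h2 (hG0 ω)
  have hlim : Tendsto (fun n => ∫ ω, rv (y (s n)) ω ∂m) atTop (𝓝 (∫ ω, G ω ∂m)) := by
    have hnn' : ∀ᵐ ω ∂m, ∀ n, 0 ≤ rv (y (s n)) ω :=
      ae_all_iff.2 fun n => hm.ae_le_qs (hnn (s n))
    have hanti : ∀ᵐ ω ∂m, Antitone fun n => rv (y (s n)) ω := by
      have : ∀ᵐ ω ∂m, ∀ n, rv (y (s (n + 1))) ω ≤ rv (y (s n)) ω :=
        ae_all_iff.2 fun n => hm.ae_le_qs (hmono _ _ (hs n.le_succ))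
      filter_upwards [this] with ω h using antitone_nat_of_succ_le h
    refine integral_tendsto_of_tendsto_of_antitone (fun n => hint _) hGi hanti ?_
    filter_upwards [hanti, hnn'] with ω h1 h2
    have e : G ω = ⨅ n, rv (y (s n)) ω := iInf_congr fun n => abs_of_nonneg (h2 n)
    rw [e]
    exact tendsto_atTop_ciInf h1 ⟨0, by rintro _ ⟨n, rfl⟩; exact h2 n⟩
  rw [integral_congr_ae hGnull, integral_zero] at hlim
  have := ge_of_tendsto' hlim fun n => hcon (s n)
  linarith

theorem orderClosed_of_isClosed {M : Set (SignedMeasure Ω)} (hM : M ⊆ sca 𝔓)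
    {C : Set (Linf 𝔓)} (hC : IsClosed[weakTopology 𝔓 M] C) : OrderClosed C := by
  rintro I _ _ _ x a hx ⟨y, hy, h0, hxy⟩
  have hlim : Tendsto x atTop (@nhds _ (weakTopology 𝔓 M) a) := by
    refine tendsto_weakTopology fun μ hμ => ?_
    obtain ⟨S, hS⟩ := (hM hμ).2
    have hμc := (hM hμ).1
    refine Metric.tendsto_nhds.2 fun ε hε => ?_
    obtain ⟨i, hi⟩ := exists_integral_lt_of_isGLB (mem_ca_iff.1 hμc) hS hy h0 hε
    filter_upwards [eventually_ge_atTop i] with j hj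
    rw [Real.dist_eq]
    exact (abs_pairing_sub_le hμc ((hxy j).trans (hy hj))).trans_lt hi
  let _ := weakTopology 𝔓 M
  exact hC.mem_of_tendsto hlim (Eventually.of_forall hx)

end OrderContinuity

/-! ### Order closed convex solid sets are weakly closed -/

section Separation

open LatticeOrderedAddCommGroup

/-- Sequences are lifted by `ULift` because the index sets of `OrderClosed` live in the universe of
the space. -/
theorem OrderClosed.mem_of_seq {E : Type u} [Lattice E] [AddCommGroup E] {C : Set E}
    (hC : OrderClosed C) {x y : ℕ → E} {a : E} (hx : ∀ n, x n ∈ C) (hy : Antitone y)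
    (h0 : IsGLB (range y) 0) (h : ∀ n, |x n - a| ≤ y n) : a ∈ C := by
  have : IsDirectedOrder (ULift.{u} ℕ) :=
    ⟨fun i j => ⟨⟨max i.down j.down⟩, le_max_left i.down j.down, le_max_right i.down j.down⟩⟩
  refine hC (ULift.{u} ℕ) (fun n => x n.down) a (fun n => hx _)
    ⟨fun n => y n.down, fun i j hij => hy hij, ?_, fun n => h _⟩
  convert h0 using 1
  ext z
  simp

/-- The restriction of a class to an event. -/
noncomputable def Linf.restrict (X : Linf 𝔓) (S : Set Ω) (hS : MeasurableSet S) : Linf 𝔓 :=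
  Linf.of 𝔓 (S.indicator (rv X)) ((Linf.measurable_rv X).indicator hS) <| by
    obtain ⟨r, hr, h⟩ := Linf.exists_bound X
    refine ⟨r, ?_⟩
    filter_upwards [h] with ω h1
    by_cases hω : ω ∈ S
    · rwa [indicator_of_mem hω]
    · rw [indicator_of_notMem hω, abs_zero]
      exact hr.le

theorem Linf.rv_restrict (X : Linf 𝔓) {S : Set Ω} (hS : MeasurableSet S) :
    rv (Linf.restrict X S hS) =ᶠ[qs 𝔓] S.indicator (rv X) :=
  Linf.rv_of _ _

/-- An order closed solid set is closed under almost sure limits on supports of measures. -/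
theorem restrict_mem_of_tendsto_ae {m : Measure Ω} {S : Set Ω} (hS : IsSupport 𝔓 m S)
    {C : Set (Linf 𝔓)} (hsol : IsSolid C) (hC : OrderClosed C) {Y : ℕ → Linf 𝔓}
    (hY : ∀ n, Y n ∈ C) {X : Linf 𝔓}
    (hlim : ∀ᵐ ω ∂m, Tendsto (fun n => rv (Y n) ω) atTop (𝓝 (rv X ω))) :
    Linf.restrict X S hS.1 ∈ C := by
  have mX := Linf.measurable_rv X
  have mY := fun n => Linf.measurable_rv (Y n)
  obtain ⟨r, hr, hXr⟩ := Linf.exists_bound X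
  -- By solidity it suffices to reach `t`. The truncations `z n` lie in `C` because they are
  -- dominated by `|Y n|`, and the tail suprema `d n` of the errors form a decreasing regulator.
  let t : Ω → ℝ := S.indicator fun ω => |rv X ω|
  let z : ℕ → Ω → ℝ := fun n => S.indicator fun ω => min |rv (Y n) ω| |rv X ω|
  let d : ℕ → Ω → ℝ := fun n ω => ⨆ k, (t ω - z (n + k) ω)
  have mt : Measurable t := mX.abs.indicator hS.1
  have mz : ∀ n, Measurable (z n) := fun n => ((mY n).abs.min mX.abs).indicator hS.1
  have md : ∀ n, Measurable (d n) := fun n => Measurable.iSup fun k => mt.sub (mz _)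
  have t0 : ∀ ω, 0 ≤ t ω := fun ω => indicator_nonneg (fun ω _ => abs_nonneg _) ω
  have tX : ∀ ω, t ω ≤ |rv X ω| := fun ω => indicator_le_self' (fun ω _ => abs_nonneg _) ω
  have z0 : ∀ n ω, 0 ≤ z n ω := fun n ω =>
    indicator_nonneg (fun ω _ => le_min (abs_nonneg _) (abs_nonneg _)) ω
  have zt : ∀ n ω, z n ω ≤ t ω := fun n ω => indicator_le_indicator (min_le_right _ _)
  have zY : ∀ n ω, z n ω ≤ |rv (Y n) ω| := fun n ω =>
    (indicator_le_self' (fun ω _ => le_min (abs_nonneg _) (abs_nonneg _)) ω).trans (min_le_left _ _)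
  have hbdd : ∀ n ω, BddAbove (range fun k => t ω - z (n + k) ω) := fun n ω =>
    ⟨t ω, by rintro _ ⟨k, rfl⟩; exact sub_le_self _ (z0 _ _)⟩
  have dle : ∀ n ω, d n ω ≤ t ω := fun n ω => ciSup_le fun k => sub_le_self _ (z0 _ _)
  have hd : ∀ n k ω, t ω - z (n + k) ω ≤ d n ω := fun n k ω => le_ciSup (hbdd n ω) k
  have d0 : ∀ n ω, 0 ≤ d n ω := fun n ω => (sub_nonneg.2 (zt _ ω)).trans (hd n 0 ω)
  have danti : ∀ n k ω, n ≤ k → d k ω ≤ d n ω := by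
    intro n k ω hnk
    refine ciSup_le fun l => ?_
    obtain ⟨j, rfl⟩ := Nat.exists_eq_add_of_le hnk
    rw [add_assoc]
    exact hd n (j + l) ω
  have dlim : ∀ᶠ ω in qs 𝔓, Tendsto (fun n => d n ω) atTop (𝓝 0) := by
    filter_upwards [hS.eventually hlim] with ω h
    by_cases hω : ω ∈ S
    · have hz : Tendsto (fun n => z n ω) atTop (𝓝 (t ω)) := by
        simp only [z, t, indicator_of_mem hω]
        simpa using (h hω).abs.min (tendsto_const_nhds (x := |rv X ω|))
      refine Metric.tendsto_atTop.2 fun ε hε => ?_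
      obtain ⟨N, hN⟩ := Metric.tendsto_atTop.1 hz (ε / 2) (half_pos hε)
      refine ⟨N, fun n hn => ?_⟩
      rw [Real.dist_eq, sub_zero, abs_of_nonneg (d0 n ω)]
      refine lt_of_le_of_lt (ciSup_le fun k => ?_) (half_lt_self hε)
      have := hN (n + k) (by omega)
      rw [Real.dist_eq, abs_lt] at this
      linarith [this.1]
    · have : ∀ n, d n ω = 0 := fun n => le_antisymm
        ((dle n ω).trans (by simp [t, hω])) (d0 n ω)
      simp [this]
  have bt : ∃ r : ℝ, ∀ᶠ ω in qs 𝔓, |t ω| ≤ r := by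
    refine ⟨r, ?_⟩
    filter_upwards [hXr] with ω h
    rw [abs_of_nonneg (t0 ω)]
    exact (tX ω).trans h
  have bz : ∀ n, ∃ r : ℝ, ∀ᶠ ω in qs 𝔓, |z n ω| ≤ r := by
    refine fun n => ⟨r, ?_⟩
    filter_upwards [hXr] with ω h
    rw [abs_of_nonneg (z0 n ω)]
    exact (zt n ω).trans ((tX ω).trans h)
  have bd : ∀ n, ∃ r : ℝ, ∀ᶠ ω in qs 𝔓, |d n ω| ≤ r := by
    refine fun n => ⟨r, ?_⟩
    filter_upwards [hXr] with ω h
    rw [abs_of_nonneg (d0 n ω)]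
    exact (dle n ω).trans ((tX ω).trans h)
  have htC : Linf.of 𝔓 t mt bt ∈ C := by
    refine hC.mem_of_seq (x := fun n => Linf.of 𝔓 (z n) (mz n) (bz n))
      (y := fun n => Linf.of 𝔓 (d n) (md n) (bd n)) (fun n => ?_) (fun n k hnk => ?_) ⟨?_, ?_⟩
      (fun n => ?_)
    · refine hsol (hY n) (Linf.abs_le_abs_iff.2 ?_)
      filter_upwards [Linf.rv_of (mz n) (bz n)] with ω h
      rw [h, abs_of_nonneg (z0 n ω)]
      exact zY n ω
    · refine Linf.le_iff.2 ?_
      filter_upwards [Linf.rv_of (md n) (bd n), Linf.rv_of (md k) (bd k)] with ω h1 h2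
      rw [h1, h2]
      exact danti n k ω hnk
    · rintro _ ⟨n, rfl⟩
      refine Linf.nonneg_iff.2 ?_
      filter_upwards [Linf.rv_of (md n) (bd n)] with ω h1
      rw [h1]
      exact d0 n ω
    · intro V hV
      refine Linf.nonpos_iff.2 ?_
      have hVd : ∀ᶠ ω in qs 𝔓, ∀ n, rv V ω ≤ d n ω := by
        refine eventually_countable_forall.2 fun n => ?_
        filter_upwards [Linf.rv_of (md n) (bd n), Linf.le_iff.1 (hV ⟨n, rfl⟩)] with ω h1 h2
        rwa [h1] at h2
      filter_upwards [hVd, dlim] with ω h1 h2 using ge_of_tendsto' h2 h1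
    · refine Linf.abs_sub_le_iff.2 ?_
      filter_upwards [Linf.rv_of (mz n) (bz n), Linf.rv_of (md n) (bd n), Linf.rv_of mt bt]
        with ω h1 h2 h3
      rw [h1, h2, h3, abs_sub_comm, abs_of_nonneg (sub_nonneg.2 (zt n ω))]
      exact hd n 0 ω
  refine hsol htC (Linf.abs_le_abs_iff.2 ?_)
  filter_upwards [Linf.rv_of mt bt, Linf.rv_restrict X hS.1] with ω h1 h2
  rw [h1, h2]
  by_cases hω : ω ∈ S <;> simp [t, hω]

/-- The canonical map into `L²` of a dominated finite measure. -/
noncomputable def toL2 (m : Measure Ω) [IsFiniteMeasure m] (hm : DominatedMeasure 𝔓 m) :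
    Linf 𝔓 →ₗ[ℝ] Lp ℝ 2 m where
  toFun X := (Linf.memLp hm X 2).toLp (rv X)
  map_add' X Y := by
    rw [← MemLp.toLp_add]
    exact MemLp.toLp_congr _ _ (hm.ae_le_qs (Linf.rv_add X Y))
  map_smul' c X := by
    rw [RingHom.id_apply, ← MemLp.toLp_const_smul]
    exact MemLp.toLp_congr _ _ (hm.ae_le_qs (Linf.rv_smul c X))

theorem coeFn_toL2 {m : Measure Ω} [IsFiniteMeasure m] (hm : DominatedMeasure 𝔓 m) (X : Linf 𝔓) :
    toL2 m hm X =ᵐ[m] rv X :=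
  MemLp.coeFn_toLp (Linf.memLp hm X 2)

/-- A point whose restriction to a support lies outside an order closed convex solid set can be
separated from this set by a supported measure. -/
theorem exists_separating_sca {m : Measure Ω} [IsFiniteMeasure m] (hm : DominatedMeasure 𝔓 m)
    {S : Set Ω} (hS : IsSupport 𝔓 m S) {C : Set (Linf 𝔓)} (hconv : Convex ℝ C) (hsol : IsSolid C)
    (hC : OrderClosed C) {X : Linf 𝔓} (hX : Linf.restrict X S hS.1 ∉ C) :
    ∃ μ ∈ sca 𝔓, ∃ r : ℝ, (∀ Y ∈ C, pairing Y μ ≤ r) ∧ r < pairing X μ := by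
  have hcl : toL2 m hm X ∉ closure (toL2 m hm '' C) := by
    intro h
    obtain ⟨x, hx, hlim⟩ := mem_closure_iff_seq_limit.1 h
    choose Y hY hYx using hx
    obtain ⟨ns, -, hns⟩ := (tendstoInMeasure_of_tendsto_Lp hlim).exists_seq_tendsto_ae
    refine hX (restrict_mem_of_tendsto_ae hS hsol hC (Y := fun n => Y (ns n))
      (fun n => hY _) ?_)
    have hae : ∀ᵐ ω ∂m, ∀ n, x n ω = rv (Y n) ω :=
      ae_all_iff.2 fun n => by rw [← hYx]; exact coeFn_toL2 hm (Y n)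
    filter_upwards [hns, hae, coeFn_toL2 hm X] with ω h1 h2 h3
    simpa only [h2, h3] using h1
  obtain ⟨φ, r, hφ, hφX⟩ := geometric_hahn_banach_closed_point
    (hconv.linear_image (toL2 m hm)).closure isClosed_closure hcl
  -- The Riesz representative of the separating functional is the density sought; `h` below is a
  -- measurable version of it.
  let g := (InnerProductSpace.toDual ℝ (Lp ℝ 2 m)).symm φ
  have hgL : Integrable g m := (Lp.memLp g).integrable (by norm_num)
  have hgm : AEStronglyMeasurable g m := Lp.aestronglyMeasurable g
  let h : Ω → ℝ := hgm.mk g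
  have hgh : g =ᵐ[m] h := hgm.ae_eq_mk
  have hh : Measurable h := hgm.stronglyMeasurable_mk.measurable
  have hhi : Integrable h m := hgL.congr hgh
  obtain ⟨μ, hμ, hpair⟩ := exists_signedMeasure_density hh hhi
  have hφpair : ∀ Y : Linf 𝔓, φ (toL2 m hm Y) = pairing Y μ := by
    intro Y
    rw [pairing_def, hpair _ (Linf.integrable_mul hm hhi Y),
      ← InnerProductSpace.toDual_symm_apply (x := toL2 m hm Y) (y := φ), L2.inner_def]
    refine integral_congr_ae ?_
    filter_upwards [hgh, coeFn_toL2 hm Y] with ω h1 h2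
    rw [h2]
    change inner ℝ (g ω) _ = _
    rw [h1]
    simp [mul_comm]
  refine ⟨μ, ⟨mem_ca_iff.2 ?_, ?_⟩, r, fun Y hY => ?_, ?_⟩
  · rw [hμ]
    exact hm.of_ac (withDensity_absolutelyContinuous _ _)
  · rw [hμ]
    exact ⟨_, hS.withDensity hh.abs.ennreal_ofReal⟩
  · rw [← hφpair]
    exact (hφ _ (subset_closure (mem_image_of_mem _ hY))).le
  · rwa [← hφpair]

/-- Under class (S), an order closed set contains `X` if it contains the restrictions of `X` to
the supports of finite dominated measures. -/
theorem mem_of_forall_restrict_mem (hP : ClassS 𝔓) {C : Set (Linf 𝔓)} (hC : OrderClosed C)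
    {X : Linf 𝔓} (h : ∀ (m : Measure Ω) (S : Set Ω), IsFiniteMeasure m → DominatedMeasure 𝔓 m →
      ∀ hS : IsSupport 𝔓 m S, Linf.restrict X S hS.1 ∈ C) : X ∈ C := by
  obtain ⟨𝔔, -, heq, hsupp⟩ := hP
  rw [equivalent_iff] at heq
  -- Supports are ordered by inclusion; the net is directed since unions support sums of measures.
  -- The regulator is `|X|` off `S`.
  let I := {S : Set Ω // ∃ m : Measure Ω, IsFiniteMeasure m ∧ DominatedMeasure 𝔓 m ∧
    IsSupport 𝔓 m S}
  have hmeas : ∀ S : I, MeasurableSet S.1 := fun S => S.2.choose_spec.2.2.1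
  have hdir : IsDirectedOrder I := by
    refine ⟨?_⟩
    rintro ⟨S, m, h1, h2, h3⟩ ⟨T, n, k1, k2, k3⟩
    exact ⟨⟨S ∪ T, m + n, inferInstance, h2.add k2, h3.add k3⟩, subset_union_left,
      subset_union_right⟩
  have hne : Nonempty I := ⟨⟨∅, 0, inferInstance, fun N _ => rfl, MeasurableSet.empty, rfl,
    fun N _ _ => by rw [inter_empty]; exact isPolar_empty⟩⟩
  refine hC I (fun S => Linf.restrict X S.1 (hmeas S)) X ?_
    ⟨fun S => Linf.restrict |X| S.1ᶜ (hmeas S).compl, ?_, ⟨?_, ?_⟩, ?_⟩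
  · rintro ⟨S, m, h1, h2, h3⟩
    exact h m S h1 h2 h3
  · intro S T hST
    refine Linf.le_iff.2 ?_
    filter_upwards [Linf.rv_restrict |X| (hmeas S).compl, Linf.rv_restrict |X| (hmeas T).compl,
      Linf.rv_abs X] with ω h1 h2 h3
    rw [h1, h2]
    refine indicator_le_indicator_apply_of_subset (compl_subset_compl.2 hST) ?_
    rw [h3]
    exact abs_nonneg _
  · rintro _ ⟨S, rfl⟩
    refine Linf.nonneg_iff.2 ?_
    filter_upwards [Linf.rv_restrict |X| (hmeas S).compl, Linf.rv_abs X] with ω h1 h3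
    rw [h1]
    refine indicator_apply_nonneg fun _ => ?_
    rw [h3]
    exact abs_nonneg _
  · intro V hV
    rw [Linf.nonpos_iff]
    have hm : MeasurableSet {ω | rv V ω ≤ 0} :=
      measurableSet_le (Linf.measurable_rv V) measurable_const
    change {ω | rv V ω ≤ 0} ∈ qs 𝔓
    rw [← isPolar_compl_iff hm, ← heq, isPolar_iff]
    -- For `Q` in the equivalent family, the support of `Q` is itself an index, and there the
    -- regulator vanishes `Q`-a.e.
    refine ⟨hm.compl, fun Q hQ => ?_⟩
    obtain ⟨S, hS⟩ := hsupp Q hQ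
    have hQd : DominatedMeasure 𝔓 (Q : Measure Ω) := fun N hN =>
      dominatedMeasure_of_mem hQ N ((heq N).2 hN)
    let i : I := ⟨S, Q, inferInstance, hQd, hS⟩
    have hSae : ∀ᵐ ω ∂(Q : Measure Ω), ω ∈ S := hS.2.1
    change ∀ᵐ ω ∂(Q : Measure Ω), rv V ω ≤ 0
    filter_upwards [hSae, hQd.ae_le_qs (Linf.le_iff.1 (hV ⟨i, rfl⟩)),
      hQd.ae_le_qs (Linf.rv_restrict |X| (hmeas i).compl)] with ω h1 h2 h3
    rw [h3, indicator_of_notMem (notMem_compl_iff.2 h1)] at h2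
    exact h2
  · intro S
    refine Linf.abs_sub_le_iff.2 ?_
    filter_upwards [Linf.rv_restrict X (hmeas S), Linf.rv_restrict |X| (hmeas S).compl,
      Linf.rv_abs X] with ω h1 h2 h3
    rw [h1, h2]
    by_cases hω : ω ∈ S.1
    · simp [hω]
    · simp [hω, h3]

theorem isClosed_of_orderClosed (hP : ClassS 𝔓) {C : Set (Linf 𝔓)} (hconv : Convex ℝ C)
    (hsol : IsSolid C) (hC : OrderClosed C) : IsClosed[weakTopology 𝔓 (sca 𝔓)] C := by
  let _ := weakTopology 𝔓 (sca 𝔓)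
  refine isClosed_of_closure_subset fun X hX => mem_of_forall_restrict_mem hP hC
    fun m S _ hm hS => ?_
  by_contra hXC
  obtain ⟨μ, hμ, r, hr, hrX⟩ := exists_separating_sca hm hS hconv hsol hC hXC
  have hcl : IsClosed {Y : Linf 𝔓 | pairing Y μ ≤ r} :=
    isClosed_Iic.preimage (continuous_pairing hμ)
  exact hrX.not_ge (closure_minimal hr hcl hX)

end Separation

/-! ### Converse implications: test sets -/

section Converse

open LatticeOrderedAddCommGroup

theorem orderClosed_zero : OrderClosed ({0} : Set (Linf 𝔓)) := by
  rintro I _ _ _ x a hx ⟨y, -, h0, hxy⟩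
  have h : |a| ≤ 0 := h0.2 <| by
    rintro _ ⟨i, rfl⟩
    have h1 := hxy i
    rw [mem_singleton_iff.1 (hx i)] at h1
    refine le_trans (b := |0 - a|) (Linf.abs_le_abs_iff.2 ?_) h1
    filter_upwards [Linf.rv_sub 0 a, Linf.rv_zero (𝔓 := 𝔓)] with ω h1 h2
    rw [h1, h2, zero_sub, abs_neg]
  rw [Linf.nonpos_iff] at h
  rw [mem_singleton_iff, Linf.eq_iff]
  filter_upwards [h, Linf.rv_abs a, Linf.rv_zero (𝔓 := 𝔓)] with ω h1 h2 h3
  rw [h2] at h1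
  rw [h3]
  exact abs_nonpos_iff.1 h1

theorem isSolid_zero : IsSolid ({0} : Set (Linf 𝔓)) := by
  intro X hX Y hY
  rw [mem_singleton_iff] at hX ⊢
  subst hX
  rw [Linf.abs_le_abs_iff] at hY
  rw [Linf.eq_iff]
  filter_upwards [hY, Linf.rv_zero (𝔓 := 𝔓)] with ω h1 h2
  rw [h2, abs_zero] at h1
  rw [h2]
  exact abs_nonpos_iff.1 h1

/-- If `{0}` is closed then the measures separate points of `L^∞_c`. -/
theorem exists_pairing_ne {M : Set (SignedMeasure Ω)}
    (h : IsClosed[weakTopology 𝔓 M] ({0} : Set (Linf 𝔓))) {X : Linf 𝔓} (hX : X ≠ 0) :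
    ∃ μ ∈ M, pairing X μ ≠ pairing (0 : Linf 𝔓) μ := by
  by_contra! hcon
  have hlim : Tendsto (fun _ : ℕ => (0 : Linf 𝔓)) atTop (@nhds _ (weakTopology 𝔓 M) X) := by
    refine tendsto_weakTopology fun μ hμ => ?_
    rw [hcon μ hμ]
    exact tendsto_const_nhds
  let _ := weakTopology 𝔓 M
  exact hX (h.mem_of_tendsto hlim (Eventually.of_forall fun _ => rfl))

/-- The class of the indicator of an event. -/
noncomputable def Linf.indicator (𝔓 : Set (ProbabilityMeasure Ω)) (A : Set Ω)
    (hA : MeasurableSet A) : Linf 𝔓 :=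
  Linf.of 𝔓 (A.indicator fun _ => (1 : ℝ)) (measurable_const.indicator hA) <| by
    refine ⟨1, Eventually.of_forall fun ω => ?_⟩
    by_cases hω : ω ∈ A <;> simp [hω]

theorem Linf.rv_indicator {A : Set Ω} (hA : MeasurableSet A) :
    rv (Linf.indicator 𝔓 A hA) =ᶠ[qs 𝔓] A.indicator fun _ => (1 : ℝ) :=
  Linf.rv_of _ _

/-- If `N` is not polar, its indicator is nonzero and some `μ` in `sca` pairs nontrivially with it,
so `|μ|` charges `N`. Normalising `|μ|` keeps its null sets and its support. -/
theorem classS_of_isClosed_zero (h𝔓 : 𝔓.Nonempty)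
    (h : IsClosed[weakTopology 𝔓 (sca 𝔓)] ({0} : Set (Linf 𝔓))) : ClassS 𝔓 := by
  let 𝔔 : Set (ProbabilityMeasure Ω) :=
    {Q | DominatedMeasure 𝔓 (Q : Measure Ω) ∧ Supported 𝔓 (Q : Measure Ω)}
  have hpolar : ∀ N, IsPolar 𝔔 N → IsPolar 𝔓 N := by
    intro N hN
    by_contra hNP
    have hX : Linf.indicator 𝔓 N hN.1 ≠ 0 := by
      intro h0
      refine hNP ?_
      rw [← compl_compl N, isPolar_compl_iff hN.1.compl]
      filter_upwards [Linf.eq_iff.1 h0, Linf.rv_indicator (𝔓 := 𝔓) hN.1,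
        Linf.rv_zero (𝔓 := 𝔓)] with ω h1 h2 h3 h4
      rw [h2, h3, indicator_of_mem h4] at h1
      exact one_ne_zero h1
    obtain ⟨μ, ⟨hμ, S, hS⟩, hne⟩ := exists_pairing_ne h hX
    have hm := mem_ca_iff.1 hμ
    have hμN : μ.totalVariation N ≠ 0 := by
      intro h0
      refine hne (sub_eq_zero.1 (abs_nonpos_iff.1 ?_))
      refine (abs_pairing_sub_le hμ (Z := Linf.indicator 𝔓 N hN.1) ?_).trans ?_
      · refine Linf.abs_sub_le_iff.2 ?_
        filter_upwards [Linf.rv_indicator (𝔓 := 𝔓) hN.1, Linf.rv_zero (𝔓 := 𝔓)] with ω h2 h3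
        rw [h2, h3, sub_zero, abs_of_nonneg (indicator_nonneg (fun _ _ => zero_le_one) _)]
      · rw [integral_congr_ae (hm.ae_le_qs (Linf.rv_indicator hN.1)),
          integral_indicator_const _ hN.1, measureReal_def, h0]
        simp
    have hμ0 : μ.totalVariation univ ≠ 0 := fun h0 => hμN (measure_mono_null (subset_univ _) h0)
    let Q : Measure Ω := (μ.totalVariation univ)⁻¹ • μ.totalVariation
    have hc : (μ.totalVariation univ)⁻¹ ≠ 0 := ENNReal.inv_ne_zero.2 (measure_ne_top _ _)
    have hQ0 : ∀ A, Q A = 0 ↔ μ.totalVariation A = 0 := fun A => by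
      simp [Q, measure_ne_top]
    have hQ : IsProbabilityMeasure Q := by
      have : NeZero μ.totalVariation := ⟨fun h0 => hμ0 (by simp [h0])⟩
      exact isProbabilityMeasureSMul
    have hQm : (⟨Q, hQ⟩ : ProbabilityMeasure Ω) ∈ 𝔔 :=
      ⟨fun A hA => (hQ0 A).2 (hm A hA), S, hS.1, (hQ0 _).2 hS.2.1,
        fun A hA h0 => hS.2.2 A hA ((hQ0 _).1 h0)⟩
    exact hμN ((hQ0 N).1 ((isPolar_iff.1 hN).2 _ hQm))
  refine ⟨𝔔, ?_, equivalent_iff.2 fun N => ⟨hpolar N, fun hN => ?_⟩, fun Q hQ => hQ.2⟩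
  · rw [nonempty_iff_ne_empty]
    intro he
    obtain ⟨P, hP⟩ := h𝔓
    -- For an empty family every event would be polar, including `univ`.
    have := dominatedMeasure_of_mem hP univ
      (hpolar univ (isPolar_iff.2 ⟨MeasurableSet.univ, by simp [he]⟩))
    simp at this
  · exact isPolar_iff.2 ⟨hN.1, fun Q hQ => hQ.1 N hN⟩

/-- Each member of `𝔓` lies in `ca`, so `𝔓` itself is a witness. -/
theorem classS_of_sca_eq_ca (h𝔓 : 𝔓.Nonempty) (h : sca 𝔓 = ca 𝔓) : ClassS 𝔓 := by
  refine ⟨𝔓, h𝔓, equivalent_iff.2 fun N => Iff.rfl, fun P hP => ?_⟩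
  have hP' : (P : Measure Ω).toSignedMeasure ∈ sca 𝔓 := by
    rw [h, mem_ca_iff, totalVariation_toSignedMeasure]
    exact dominatedMeasure_of_mem hP
  simpa [totalVariation_toSignedMeasure] using hP'.2

/-! ### Balls of `L¹` and existence of supports -/

section Ball

variable {m : Measure Ω} [IsFiniteMeasure m]

/-- The `L¹(m)`-ball in `L^∞_c`. -/
def l1Ball (𝔓 : Set (ProbabilityMeasure Ω)) (m : Measure Ω) (r : ℝ) : Set (Linf 𝔓) :=
  {X | ∫ ω, |rv X ω| ∂m ≤ r}

theorem isSolid_l1Ball (hm : DominatedMeasure 𝔓 m) (r : ℝ) : IsSolid (l1Ball 𝔓 m r) := by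
  intro X hX Y hY
  exact (integral_mono_ae (Linf.integrable hm Y).abs (Linf.integrable hm X).abs
    (hm.ae_le_qs (Linf.abs_le_abs_iff.1 hY))).trans hX

theorem convex_l1Ball (hm : DominatedMeasure 𝔓 m) (r : ℝ) : Convex ℝ (l1Ball 𝔓 m r) := by
  intro X hX Y hY a b ha hb hab
  have iX := (Linf.integrable hm X).abs
  have iY := (Linf.integrable hm Y).abs
  have h1 : ∫ ω, |rv (a • X + b • Y) ω| ∂m ≤ ∫ ω, (a * |rv X ω| + b * |rv Y ω|) ∂m := by
    refine integral_mono_ae (Linf.integrable hm _).abs ((iX.const_mul a).add (iY.const_mul b)) ?_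
    filter_upwards [hm.ae_le_qs (Linf.rv_add (a • X) (b • Y)), hm.ae_le_qs (Linf.rv_smul a X),
      hm.ae_le_qs (Linf.rv_smul b Y)] with ω h1 h2 h3
    rw [h1, h2, h3]
    refine (abs_add_le _ _).trans ?_
    rw [abs_mul, abs_mul, abs_of_nonneg ha, abs_of_nonneg hb]
  rw [integral_add (iX.const_mul a) (iY.const_mul b), integral_const_mul,
    integral_const_mul] at h1
  have hX' : ∫ ω, |rv X ω| ∂m ≤ r := hX
  have hY' : ∫ ω, |rv Y ω| ∂m ≤ r := hY
  change ∫ ω, |rv (a • X + b • Y) ω| ∂m ≤ r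
  calc _ ≤ _ := h1
    _ ≤ a * r + b * r := by gcongr
    _ = r := by rw [← add_mul, hab, one_mul]

theorem isClosed_l1Ball (hm : DominatedMeasure 𝔓 m) (r : ℝ) :
    IsClosed[weakTopology 𝔓 (ca 𝔓)] (l1Ball 𝔓 m r) := by
  let _ := weakTopology 𝔓 (ca 𝔓)
  refine isClosed_of_closure_subset fun X hX => ?_
  -- The measure with density `sign X` attains the `L¹`-norm at `X`, and its pairing is at most the
  -- `L¹`-norm elsewhere, so one half-space separates.
  let h : Ω → ℝ := fun ω => SignType.sign (rv X ω)
  have hh : Measurable h := by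
    have : h = fun ω => if 0 < rv X ω then 1 else if rv X ω < 0 then -1 else 0 := by
      funext ω
      simp only [h, sign_apply]
      split_ifs <;> simp
    rw [this]
    have mX := Linf.measurable_rv X
    exact Measurable.ite (measurableSet_lt measurable_const mX) measurable_const
      (Measurable.ite (measurableSet_lt mX measurable_const) measurable_const measurable_const)
  have habs : ∀ ω, |h ω| ≤ 1 := by
    intro ω
    rcases lt_trichotomy (rv X ω) 0 with h0 | h0 | h0 <;> simp [h, h0]
  have hi : Integrable h m :=
    Integrable.of_bound hh.aestronglyMeasurable 1 (Eventually.of_forall habs)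
  obtain ⟨μ, hμ, hpair⟩ := exists_signedMeasure_density hh hi
  have hμc : μ ∈ ca 𝔓 := by
    rw [mem_ca_iff, hμ]
    exact hm.of_ac (withDensity_absolutelyContinuous _ _)
  have hcl : IsClosed {Y : Linf 𝔓 | pairing Y μ ≤ r} :=
    isClosed_Iic.preimage (continuous_pairing hμc)
  have hsub : l1Ball 𝔓 m r ⊆ {Y : Linf 𝔓 | pairing Y μ ≤ r} := by
    intro Y hY
    refine le_trans ?_ (show ∫ ω, |rv Y ω| ∂m ≤ r from hY)
    rw [pairing_def, hpair _ (Linf.integrable_mul hm hi Y)]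
    refine integral_mono (Linf.integrable_mul hm hi Y) (Linf.integrable hm Y).abs fun ω => ?_
    calc h ω * rv Y ω ≤ |h ω * rv Y ω| := le_abs_self _
      _ = |h ω| * |rv Y ω| := abs_mul _ _
      _ ≤ 1 * |rv Y ω| := by gcongr; exact habs ω
      _ = |rv Y ω| := one_mul _
  have hXr : pairing X μ ≤ r := closure_minimal hsub hcl hX
  rw [pairing_def, hpair _ (Linf.integrable_mul hm hi X)] at hXr
  change ∫ ω, |rv X ω| ∂m ≤ r
  simpa only [h, sign_mul_self] using hXr

/-- A finite dominated measure all of whose `L¹`-balls are order closed is supported. -/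
theorem supported_of_orderClosed_l1Ball (hm : DominatedMeasure 𝔓 m)
    (h : ∀ r : ℝ, 0 ≤ r → OrderClosed (l1Ball 𝔓 m r)) : Supported 𝔓 m := by
  -- Events containing every `m`-null event up to a polar one. Stability under countable
  -- intersections gives a member `B₀` of least measure; when `B₀` is null, its complement is a
  -- support.
  let U : Set (Set Ω) :=
    {B | MeasurableSet B ∧ ∀ A, MeasurableSet A → m A = 0 → IsPolar 𝔓 (A \ B)}
  have hUuniv : univ ∈ U := ⟨MeasurableSet.univ, fun A _ _ => by simpa using isPolar_empty⟩
  have hUinter : ∀ B : ℕ → Set Ω, (∀ n, B n ∈ U) → (⋂ n, B n) ∈ U := fun B hB =>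
    ⟨MeasurableSet.iInter fun n => (hB n).1, fun A hA h0 => by
      rw [sdiff_iInter]
      exact isPolar_iUnion fun n => (hB n).2 A hA h0⟩
  obtain ⟨B₀, hB₀, hmin⟩ : ∃ B₀ ∈ U, ∀ B ∈ U, m B₀ ≤ m B := by
    have hne : (m '' U).Nonempty := ⟨_, mem_image_of_mem _ hUuniv⟩
    obtain ⟨u, -, hu, huU⟩ := exists_seq_tendsto_sInf hne (OrderBot.bddBelow _)
    choose B hBU hBu using huU
    refine ⟨⋂ n, B n, hUinter B hBU, fun B' hB' => ?_⟩
    refine le_trans ?_ (sInf_le (mem_image_of_mem m hB'))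
    exact ge_of_tendsto' hu fun n => (measure_mono (iInter_subset _ n)).trans_eq (hBu n)
  rcases eq_or_ne (m B₀) 0 with h0 | h0
  · refine ⟨B₀ᶜ, hB₀.1.compl, by rwa [compl_compl], fun N hN hN0 => ?_⟩
    have := hB₀.2 _ (hN.inter hB₀.1.compl) hN0
    rwa [sdiff_eq, inter_assoc, inter_self] at this
  exfalso
  -- The net `1_{B \ A}`, with `B` in `U` shrinking and `A` null growing, will decrease to `0`. The
  -- order dual makes larger indices carry smaller `B`.
  let J := {p : (Set Ω)ᵒᵈ × Set Ω // OrderDual.ofDual p.1 ∈ U ∧ MeasurableSet p.2 ∧ m p.2 = 0}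
  let b : J → Set Ω := fun p => OrderDual.ofDual p.1.1
  have hJle : ∀ p q : J, p ≤ q ↔ b q ⊆ b p ∧ p.1.2 ⊆ q.1.2 := fun p q => Iff.rfl
  have hmeas : ∀ p : J, MeasurableSet (b p \ p.1.2) := fun p => p.2.1.1.diff p.2.2.1
  have : Nonempty J := ⟨⟨(OrderDual.toDual univ, ∅), hUuniv, MeasurableSet.empty, measure_empty⟩⟩
  have : IsDirectedOrder J := by
    refine ⟨?_⟩
    intro p q
    have hU : b p ∩ b q ∈ U := ⟨p.2.1.1.inter q.2.1.1, fun D hD hD0 => by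
      rw [sdiff_inter]
      exact (p.2.1.2 D hD hD0).union (q.2.1.2 D hD hD0)⟩
    refine ⟨⟨(OrderDual.toDual (b p ∩ b q), p.1.2 ∪ q.1.2), hU, p.2.2.1.union q.2.2.1,
      measure_union_null p.2.2.2 q.2.2.2⟩, ?_, ?_⟩
    · exact (hJle _ _).2 ⟨inter_subset_left, subset_union_left⟩
    · exact (hJle _ _).2 ⟨inter_subset_right, subset_union_right⟩
  set r : ℝ := m.real B₀ᶜ with hr
  have hint : ∀ (A : Set Ω) (hA : MeasurableSet A),
      ∫ ω, |rv (Linf.indicator 𝔓 A hA) ω| ∂m = m.real A := by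
    intro A hA
    have e : ∫ ω, |rv (Linf.indicator 𝔓 A hA) ω| ∂m = ∫ ω, A.indicator (fun _ => (1 : ℝ)) ω ∂m := by
      refine integral_congr_ae ?_
      filter_upwards [hm.ae_le_qs (Linf.rv_indicator hA)] with ω h1
      rw [h1, abs_of_nonneg (indicator_nonneg (fun _ _ => zero_le_one) _)]
    rw [e, integral_indicator_const _ hA, smul_eq_mul, mul_one]
  -- Removing a null `A` does not change the measure of `B`, so each complement of `B \ A` has
  -- measure at most that of the complement of `B₀`. These indicators order converge to `1`.
  have hone : Linf.indicator 𝔓 univ MeasurableSet.univ ∈ l1Ball 𝔓 m r := by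
    refine h r measureReal_nonneg J (fun p => Linf.indicator 𝔓 _ (hmeas p).compl) _ (fun p => ?_)
      ⟨fun p => Linf.indicator 𝔓 _ (hmeas p), ?_, ⟨?_, ?_⟩, ?_⟩
    · change ∫ ω, |rv (Linf.indicator 𝔓 _ (hmeas p).compl) ω| ∂m ≤ r
      rw [hint, hr, measureReal_compl (hmeas p), measureReal_compl hB₀.1]
      have h1 : m (b p \ p.1.2) = m (b p) := measure_sdiff_null p.2.2.2
      rw [measureReal_def m (b p \ p.1.2), h1, ← measureReal_def]
      exact sub_le_sub_left
        (ENNReal.toReal_mono (measure_ne_top _ _) (hmin _ p.2.1)) _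
    · intro p q hpq
      refine Linf.le_iff.2 ?_
      filter_upwards [Linf.rv_indicator (hmeas p), Linf.rv_indicator (hmeas q)] with ω h1 h2
      rw [h1, h2]
      exact indicator_le_indicator_apply_of_subset
        (sdiff_subset_sdiff ((hJle p q).1 hpq).1 ((hJle p q).1 hpq).2) zero_le_one
    · rintro _ ⟨p, rfl⟩
      refine Linf.nonneg_iff.2 ?_
      filter_upwards [Linf.rv_indicator (hmeas p)] with ω h1
      rw [h1]
      exact indicator_apply_nonneg fun _ => zero_le_one
    · intro V hV
      have hpos : MeasurableSet {ω | 0 < rv V ω} :=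
        measurableSet_lt measurable_const (Linf.measurable_rv V)
      have hVle : ∀ p : J, ∀ᶠ ω in qs 𝔓, 0 < rv V ω → ω ∈ b p ∧ ω ∉ p.1.2 := by
        intro p
        filter_upwards [Linf.le_iff.1 (hV ⟨p, rfl⟩), Linf.rv_indicator (hmeas p)]
          with ω h1 h2 h3
        by_contra hn
        rw [h2, indicator_of_notMem (show ω ∉ b p \ p.1.2 from hn)] at h1
        exact h1.not_gt h3
      -- For a lower bound `V`, the event `{V > 0}` avoids every null `A` up to a polar set, so
      -- deleting it keeps `B₀` in `U`. Using the deleted set as an index then forces `V ≤ 0`.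
      have hB : B₀ \ {ω | 0 < rv V ω} ∈ U := by
        refine ⟨hB₀.1.diff hpos, fun A hA hA0 => ?_⟩
        have hp : IsPolar 𝔓 (A ∩ {ω | 0 < rv V ω}) := by
          rw [← compl_compl (A ∩ _), isPolar_compl_iff (hA.inter hpos).compl]
          filter_upwards [hVle ⟨(OrderDual.toDual B₀, A), hB₀, hA, hA0⟩] with ω h1 h2
          exact (h1 h2.2).2 h2.1
        refine ((hB₀.2 A hA hA0).union hp).mono (hA.diff (hB₀.1.diff hpos)) ?_
        rintro ω ⟨h1, h2⟩
        by_cases h3 : ω ∈ B₀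
        · right
          refine ⟨h1, ?_⟩
          by_contra h4
          exact h2 ⟨h3, h4⟩
        · exact Or.inl ⟨h1, h3⟩
      refine Linf.nonpos_iff.2 ?_
      filter_upwards [hVle ⟨(OrderDual.toDual (B₀ \ {ω | 0 < rv V ω}), ∅), hB,
        MeasurableSet.empty, measure_empty⟩] with ω h1
      exact not_lt.1 fun h2 => (h1 h2).1.2 h2
    · intro p
      refine Linf.abs_sub_le_iff.2 ?_
      filter_upwards [Linf.rv_indicator (hmeas p), Linf.rv_indicator (hmeas p).compl,
        Linf.rv_indicator (𝔓 := 𝔓) MeasurableSet.univ] with ω h1 h2 h3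
      rw [h1, h2, h3]
      by_cases hω : ω ∈ b p \ p.1.2
      · rw [indicator_of_mem hω, indicator_of_notMem (notMem_compl_iff.2 hω)]
        simp
      · rw [indicator_of_notMem hω, indicator_of_mem (mem_compl hω)]
        simp
  have h1 : m.real univ ≤ r := by
    rw [← hint univ MeasurableSet.univ]
    exact hone
  rw [hr, measureReal_compl hB₀.1] at h1
  have h2 : 0 < m.real B₀ := ENNReal.toReal_pos h0 (measure_ne_top _ _)
  linarith

end Ball

end Converse

end QuasiSure

/-! ### The two equivalences -/

theorem corollary4p4 {Ω : Type u} [MeasurableSpace Ω] (𝔓 : Set (ProbabilityMeasure Ω))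
    (h𝔓 : 𝔓.Nonempty) :
    (QuasiSure.ClassS 𝔓 ↔
      ∀ C : Set (QuasiSure.Linf 𝔓), C.Nonempty → Convex ℝ C →
        LatticeOrderedAddCommGroup.IsSolid C →
        (QuasiSure.OrderClosed C ↔
          IsClosed[QuasiSure.weakTopology 𝔓 (QuasiSure.sca 𝔓)] C)) ∧
    (QuasiSure.sca 𝔓 = QuasiSure.ca 𝔓 ↔
      ∀ C : Set (QuasiSure.Linf 𝔓), C.Nonempty → Convex ℝ C →
        LatticeOrderedAddCommGroup.IsSolid C →
        (QuasiSure.OrderClosed C ↔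
          IsClosed[QuasiSure.weakTopology 𝔓 (QuasiSure.ca 𝔓)] C)) := by
  have key : QuasiSure.ClassS 𝔓 → ∀ C : Set (QuasiSure.Linf 𝔓), C.Nonempty → Convex ℝ C →
      LatticeOrderedAddCommGroup.IsSolid C →
      (QuasiSure.OrderClosed C ↔
        IsClosed[QuasiSure.weakTopology 𝔓 (QuasiSure.sca 𝔓)] C) := fun hS C _ hconv hsol =>
    ⟨QuasiSure.isClosed_of_orderClosed hS hconv hsol,
      QuasiSure.orderClosed_of_isClosed Subset.rfl⟩
  refine ⟨⟨key, fun h => ?_⟩, fun h => ?_, fun h => ?_⟩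
  · exact QuasiSure.classS_of_isClosed_zero h𝔓 ((h {0} (singleton_nonempty 0)
      (convex_singleton 0) QuasiSure.isSolid_zero).1 QuasiSure.orderClosed_zero)
  · rw [← h]
    exact key (QuasiSure.classS_of_sca_eq_ca h𝔓 h)
  · refine Subset.antisymm (fun μ hμ => hμ.1) fun μ hμ => ⟨hμ, ?_⟩
    have hm := QuasiSure.mem_ca_iff.1 hμ
    refine QuasiSure.supported_of_orderClosed_l1Ball hm fun r hr => ?_
    -- The ball is nonempty because `0 ≤ r` puts `0` in it.
    refine (h _ ⟨0, ?_⟩ (QuasiSure.convex_l1Ball hm r) (QuasiSure.isSolid_l1Ball hm r)).2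
      (QuasiSure.isClosed_l1Ball hm r)
    change ∫ ω, |QuasiSure.rv 0 ω| ∂_ ≤ r
    rwa [integral_congr_ae (g := fun _ => 0), integral_zero]
    filter_upwards [hm.ae_le_qs QuasiSure.Linf.rv_zero] with ω h0
    rw [h0, abs_zero]
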